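/- Let $G=(V,E)$ be a finite simple graph with $n$ vertices and $m$ edges, let $q>1$ and $p\in(0,1)$. For $A\subseteq E$ let $c(A)$ be the number of connected components of $(V,A)$ (isolated vertices included), and let $$\mu(A)=\frac1Z\,p^{|A|}(1-p)^{|E|-|A|}q^{c(A)},\qquad Z=\sum_{A\subseteq E}p^{|A|}(1-p)^{|E|-|A|}q^{c(A)},$$ be the random-cluster measure on the subsets of $E$. Consider two Markov chains on the subsets of $E$. * The heat-bath Glauber dynamics (GD): from $A$, pick $e\in E$ uniformly at random; move to $A\cup\{e\}$ with probability $\mu(A\cup\{e\})/(\mu(A\cup\{e\})+\mu(A\setminus\{e\}))$, and otherwise to $A\setminus\{e\}$. * The Chayes--Machta dynamics (CM): from $A$, activate each connected component of $(V,A)$ independently with probability $1/q$; remove all edges joining two active vertices; then add each edge of $G$ joining two active vertices independently with probability $p$, leaving the rest of the configuration unchanged. For a chain $P$ among these let $$\tau_{\mathrm{mix}}(P)=\max_{A\subseteq E}\ \min\bigl\{t\ge 0:\ \|P^t(A,\cdot)-\mu\|_{\mathrm{TV}}\le \tfrac14\bigr\},$$ where $\|\cdot\|_{\mathrm{TV}}$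 is the total variation distance. Theorem. There is an absolute constant $C>0$ (independent of $G$, $n$, $m$, $p$ and $q$) such that for every finite simple graph $G$ with $n$ vertices and $m$ edges, every real $q>1$ and every $p\in(0,1)$, $$\tau_{\mathrm{mix}}(\mathrm{GD})\ \le\ C\Bigl(m\,n\log n+p\,m^2\log n\cdot\log\frac1{\min\{p,1-p\}}\Bigr)\cdot\tau_{\mathrm{mix}}(\mathrm{CM}).$$ -/

import Mathlib

open scoped ENNReal

noncomputable section

namespace RandomCluster

/-- Total variation distance between two distributions on a finite set. -/
def tvDist {Ω : Type*} [Fintype Ω] (a b : Ω → ℝ) : ℝ :=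
  (1 / 2) * ∑ x, |a x - b x|

/-- The `ε`-mixing time of a chain with transition matrix `P` and stationary distribution `π`:
the maximum over starting states `x` of the least `t ≥ 0` with `‖P ^ t (x, ·) - π‖_TV ≤ ε`.
It takes values in `ℕ∞`, and is `⊤` when the distance to `π` never drops to `ε`
from some starting state. -/
def mixingTime {Ω : Type*} [Fintype Ω] [DecidableEq Ω]
    (P : Matrix Ω Ω ℝ) (π : Ω → ℝ) (ε : ℝ) : ℕ∞ :=
  ⨆ x : Ω, ⨅ (t : ℕ) (_ : tvDist (fun y => (P ^ t) x y) π ≤ ε), (t : ℕ∞)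

section Model

variable {V : Type*} [Fintype V] [DecidableEq V] (G : SimpleGraph V) [DecidableRel G.Adj]

/-- Random-cluster configurations: all subsets of the edge set of `G`. -/
abbrev Config : Type _ := Finset G.edgeSet

variable {G}

/-- The spanning subgraph `(V, A)` of `G`. -/
def subgraphOf (A : Config G) : SimpleGraph V :=
  SimpleGraph.fromEdgeSet (Subtype.val '' (A : Set G.edgeSet))

/-- The connected components of `(V, A)`; isolated vertices are components. -/
abbrev Component (A : Config G) : Type _ := (subgraphOf A).ConnectedComponent

/-- The number `c(A)` of connected components of `(V, A)`. -/
def numComponents (A : Config G) : ℕ := Nat.card (Component A)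

/-- The unnormalized weight `p ^ |A| (1 - p) ^ (|E| - |A|) q ^ c(A)`. -/
def weight (p q : ℝ) (A : Config G) : ℝ :=
  p ^ A.card * (1 - p) ^ (Aᶜ).card * q ^ numComponents A

variable (G)

/-- The partition function `Z(G, p, q)`. -/
def partitionFunction (p q : ℝ) : ℝ := ∑ A : Config G, weight p q A

/-- The random-cluster measure `μ_{G,p,q}`. -/
def rcMeasure (p q : ℝ) (A : Config G) : ℝ := weight p q A / partitionFunction G p q

/-- The heat-bath Glauber dynamics: pick an edge `e` uniformly at random, move from `A` to `A ∪ {e}`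
with probability `μ(A ∪ {e}) / (μ(A ∪ {e}) + μ(A \ {e}))`, and to `A \ {e}` otherwise. -/
def glauber (p q : ℝ) : Matrix (Config G) (Config G) ℝ := fun A B =>
  ∑ e : G.edgeSet, (1 / (Fintype.card G.edgeSet : ℝ)) *
    (let r := rcMeasure G p q (insert e A) /
        (rcMeasure G p q (insert e A) + rcMeasure G p q (A.erase e))
     (if B = insert e A then r else 0) + (if B = A.erase e then 1 - r else 0))

variable {G}

open Classical in
/-- The edges of `G` both of whose endpoints are active, when the components of `(V, A)` that
belong to `S` are active. -/
def activeEdges (A : Config G) (S : Finset (Component A)) : Config G :=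
  Finset.univ.filter fun e => ∀ v ∈ (e : Sym2 V), (subgraphOf A).connectedComponentMk v ∈ S

variable (G)

open Classical in
/-- The Chayes–Machta dynamics: each connected component of `(V, A)` is activated independently
with probability `1 / q` (`S` is the set of activated components); all edges between active
vertices are removed and each edge of `G` between active vertices is then added independently
with probability `p`; all other edges keep their state. -/
def chayesMachta (p q : ℝ) : Matrix (Config G) (Config G) ℝ := fun A B =>
  ∑ S : Finset (Component A),
    ((1 / q) ^ S.card * (1 - 1 / q) ^ (Sᶜ).card) *
      (if B \ activeEdges A S = A \ activeEdges A S then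
        p ^ (B ∩ activeEdges A S).card * (1 - p) ^ (activeEdges A S \ B).card
      else 0)

end Model

end RandomCluster

end

/-!
The two chains are compared through their spectral gaps. For a fixed set `W` of active vertices,
consider the joint weight of a configuration `A` and the event that `W` is active: the factor
`q ^ c(A)` cancels the activation factors `1 / q` of the components inside `W`, and edges inside `W`
do not affect the components outside `W`, so the edges inside `W` are independent with parameter
`p`. A Chayes–Machta step is therefore a mixture over `W` of orthogonal projections, each
resampling the edges inside `W`. The Efron–Stein inequality bounds its Dirichlet form by a sum of
single-edge terms, and since a present edge lies inside `W` with probability `1 / q`, its Dirichlet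
form is at most `m / q` times that of the Glauber dynamics, which is an average of projections as
well.

If the Chayes–Machta dynamics mixes in `τ` steps, its gap is at least `1 / (2 τ)`, so the Glauber
dynamics has gap at least `q / (2 m τ)`. Starting the `L²` contraction from an arbitrary
configuration would cost `log (1 / min μ)`. Instead, after `m log (16 m)` steps the configuration
has at most `16 p m` edges with probability at least `7 / 8`, and for such `A` the quantity
`log (1 / μ(A))` is only `O(n q + p m log (1 / min p (1 - p)))`. The factor `q` gained in the
comparison absorbs the one here.
-/

noncomputable section

namespace RandomCluster

open Finset Matrix

section PosSemidefForms

variable {M : Type*} [AddCommGroup M] [Module ℝ M] {B : LinearMap.BilinForm ℝ M}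

/-- `T` is an orthogonal projection with respect to the form `B`, which may be degenerate. -/
structure IsOrthProj (B : LinearMap.BilinForm ℝ M) (T : Module.End ℝ M) : Prop where
  isSelfAdjoint : B.IsSelfAdjoint T
  isIdempotentElem : IsIdempotentElem T

namespace IsOrthProj

variable {S T : Module.End ℝ M}

lemma one : IsOrthProj B 1 := ⟨LinearMap.isAdjointPair_one, .one⟩

lemma mul (hS : IsOrthProj B S) (hT : IsOrthProj B T) (hST : Commute S T) :
    IsOrthProj B (S * T) where
  isSelfAdjoint := by
    have h := hS.isSelfAdjoint.mul hT.isSelfAdjoint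
    rwa [← hST.eq] at h
  isIdempotentElem := hS.isIdempotentElem.mul_of_commute hST hT.isIdempotentElem

lemma one_sub (hT : IsOrthProj B T) : IsOrthProj B (1 - T) :=
  ⟨one.isSelfAdjoint.sub hT.isSelfAdjoint, hT.isIdempotentElem.one_sub⟩

lemma apply_self (hT : IsOrthProj B T) (f : M) : B f (T f) = B (T f) (T f) := by
  rw [hT.isSelfAdjoint, ← Module.End.mul_apply, hT.isIdempotentElem.eq]

lemma apply_self_le (hT : IsOrthProj B T) (hB : B.IsNonneg) (f : M) : B f (T f) ≤ B f f := by
  have h := hB.nonneg ((1 - T) f)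
  rw [← hT.one_sub.apply_self] at h
  simpa using h

lemma apply_mul_self_le (hS : IsOrthProj B S) (hT : IsOrthProj B T) (hB : B.IsNonneg)
    (hST : Commute S T) (f : M) : B f ((S * T) f) ≤ B f (T f) := by
  have hSTT : S * T = T * S * T := by rw [← hST.eq, mul_assoc, hT.isIdempotentElem.eq]
  calc B f ((S * T) f) = B (T f) (S (T f)) := by
        rw [hT.isSelfAdjoint, hSTT, Module.End.mul_apply, Module.End.mul_apply]
    _ ≤ B (T f) (T f) := hS.apply_self_le hB _
    _ = B f (T f) := (hT.apply_self f).symm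

lemma apply_sub_mul_self_le (hS : IsOrthProj B S) (hT : IsOrthProj B T) (hB : B.IsNonneg)
    (hST : Commute S T) (f : M) :
    B f (f - (S * T) f) ≤ B f (f - S f) + B f (f - T f) := by
  have hdecomp : f - (S * T) f = (f - S f) + (S * (1 - T)) f := by
    simp [mul_sub]
  rw [hdecomp, map_add]
  exact add_le_add_right
    (hS.apply_mul_self_le hT.one_sub hB ((Commute.one_right S).sub_right hST) f) _

variable {ι : Type*} {U : ι → Module.End ℝ M}

lemma noncommProd {D : Finset ι} (hU : ∀ i ∈ D, IsOrthProj B (U i))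
    (hcomm : (D : Set ι).Pairwise (Function.onFun Commute U)) :
    IsOrthProj B (D.noncommProd U hcomm) := by
  classical
  induction D using Finset.induction_on with
  | empty => exact one
  | insert i D hi ih =>
    rw [noncommProd_insert_of_notMem _ _ _ _ hi]
    refine (hU i (mem_insert_self i D)).mul (ih (fun j hj => hU j (mem_insert_of_mem hj)) _) ?_
    exact noncommProd_commute _ _ _ _ fun j hj =>
      hcomm (mem_insert_self i D) (mem_insert_of_mem hj) (ne_of_mem_of_not_mem hj hi).symm

/-- The Efron–Stein inequality, in its operator form. -/
lemma apply_sub_noncommProd_self_le {D : Finset ι} (hU : ∀ i ∈ D, IsOrthProj B (U i))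
    (hcomm : (D : Set ι).Pairwise (Function.onFun Commute U)) (hB : B.IsNonneg) (f : M) :
    B f (f - D.noncommProd U hcomm f) ≤ ∑ i ∈ D, B f (f - U i f) := by
  classical
  induction D using Finset.induction_on with
  | empty => simp
  | insert i D hi ih =>
    have hD : ∀ j ∈ D, IsOrthProj B (U j) := fun j hj => hU j (mem_insert_of_mem hj)
    rw [noncommProd_insert_of_notMem _ _ _ _ hi, sum_insert hi]
    refine ((hU i (mem_insert_self i D)).apply_sub_mul_self_le (noncommProd hD _) hB ?_ f).trans
      (add_le_add_right (ih hD _) _)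
    exact noncommProd_commute _ _ _ _ fun j hj =>
      hcomm (mem_insert_self i D) (mem_insert_of_mem hj) (ne_of_mem_of_not_mem hj hi).symm

end IsOrthProj

lemma apply_sum_smul_self_le {ι : Type*} {s : Finset ι} (hB : B.IsPosSemidef) {c : ι → ℝ}
    (hc : ∀ i ∈ s, 0 ≤ c i) (hsum : ∑ i ∈ s, c i = 1) (x : ι → M) :
    B (∑ i ∈ s, c i • x i) (∑ i ∈ s, c i • x i) ≤ ∑ i ∈ s, c i * B (x i) (x i) := by
  set y := ∑ i ∈ s, c i • x i with hy
  have hvar : 0 ≤ ∑ i ∈ s, c i * B (x i - y) (x i - y) :=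
    sum_nonneg fun i hi => mul_nonneg (hc i hi) (hB.nonneg _)
  have hcross : ∑ i ∈ s, c i * B (x i) y = B y y := by
    conv_rhs => rw [hy, LinearMap.map_sum₂, ← hy]
    exact sum_congr rfl fun i _ => by rw [LinearMap.map_smul₂, smul_eq_mul]
  have hexpand : ∑ i ∈ s, c i * B (x i - y) (x i - y)
      = ∑ i ∈ s, c i * B (x i) (x i) - 2 * ∑ i ∈ s, c i * B (x i) y
        + (∑ i ∈ s, c i) * B y y := by
    rw [mul_sum, sum_mul, ← sum_sub_distrib, ← sum_add_distrib]
    refine sum_congr rfl fun i _ => ?_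
    have hsymm : B y (x i) = B (x i) y := hB.isSymm.eq _ _
    simp only [map_sub, LinearMap.sub_apply, hsymm]
    ring
  rw [hexpand, hcross, hsum] at hvar
  linarith

lemma apply_average_self_le {ι : Type*} [Fintype ι] [Nonempty ι] (hB : B.IsPosSemidef)
    {U : ι → Module.End ℝ M} (hU : ∀ i, IsOrthProj B (U i)) {A : Module.End ℝ M}
    (hA : A = (1 / (Fintype.card ι : ℝ)) • ∑ i, U i) (f : M) :
    B (A f) (A f) ≤ B f (A f) := by
  have hAf : A f = ∑ i, (1 / (Fintype.card ι : ℝ)) • U i f := by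
    rw [hA, ← smul_sum, LinearMap.smul_apply, LinearMap.sum_apply]
  calc B (A f) (A f) ≤ ∑ i, 1 / (Fintype.card ι : ℝ) * B (U i f) (U i f) := by
        rw [hAf]
        exact apply_sum_smul_self_le hB (fun _ _ => by positivity) (by simp) _
    _ = B f (A f) := by
        simp only [hAf, map_sum, map_smul, smul_eq_mul, (hU _).apply_self]

lemma sq_apply_le (hB : B.IsPosSemidef) (f g : M) : B f g ^ 2 ≤ B f f * B g g :=
  B.apply_sq_le_of_symm hB.nonneg (LinearMap.BilinForm.isSymm_iff.1 hB.isSymm) f g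

variable {T : Module.End ℝ M}

lemma sq_mul_apply_self_le_of_rayleigh (hB : B.IsPosSemidef) {ρ : ℝ} (hρ : 0 ≤ ρ) {f : M}
    (hf : ρ * B f f ≤ B f (T f)) : ρ ^ 2 * B f f ≤ B (T f) (T f) := by
  rcases (hB.nonneg f).eq_or_lt with hff | hff
  · simpa only [← hff, mul_zero] using hB.nonneg (T f)
  · refine le_of_mul_le_mul_left ?_ hff
    calc B f f * (ρ ^ 2 * B f f) = (ρ * B f f) ^ 2 := by ring
      _ ≤ B f (T f) ^ 2 := pow_le_pow_left₀ (mul_nonneg hρ hff.le) hf 2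
      _ ≤ B f f * B (T f) (T f) := sq_apply_le hB _ _

lemma sq_mul_apply_self_le_step (hB : B.IsPosSemidef) (hT : B.IsSelfAdjoint T) {ρ : ℝ} {f : M}
    (hf : ρ ^ 2 * B f f ≤ B (T f) (T f)) :
    ρ ^ 2 * B (T f) (T f) ≤ B (T (T f)) (T (T f)) := by
  rcases (hB.nonneg (T f)).eq_or_lt with hTf | hTf
  · simpa only [← hTf, mul_zero] using hB.nonneg (T (T f))
  · refine le_of_mul_le_mul_left ?_ hTf
    calc B (T f) (T f) * (ρ ^ 2 * B (T f) (T f)) = ρ ^ 2 * B f (T (T f)) ^ 2 := by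
          rw [← hT f (T f)]; ring
      _ ≤ ρ ^ 2 * (B f f * B (T (T f)) (T (T f))) := by
          gcongr; exact sq_apply_le hB _ _
      _ = (ρ ^ 2 * B f f) * B (T (T f)) (T (T f)) := by ring
      _ ≤ B (T f) (T f) * B (T (T f)) (T (T f)) := by gcongr; exact hB.nonneg _

/-- Log-convexity of `k ↦ B (T ^ k f) (T ^ k f)` makes the first ratio the worst one. -/
lemma pow_mul_apply_self_le_of_rayleigh (hB : B.IsPosSemidef) (hT : B.IsSelfAdjoint T) {ρ : ℝ}
    (hρ : 0 ≤ ρ) {f : M} (hf : ρ * B f f ≤ B f (T f)) (k : ℕ) :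
    (ρ ^ k) ^ 2 * B f f ≤ B ((T ^ k) f) ((T ^ k) f) := by
  have hsucc (k : ℕ) : (T ^ (k + 1)) f = T ((T ^ k) f) := by rw [pow_succ', Module.End.mul_apply]
  have hstep (k : ℕ) :
      ρ ^ 2 * B ((T ^ k) f) ((T ^ k) f) ≤ B ((T ^ (k + 1)) f) ((T ^ (k + 1)) f) := by
    induction k with
    | zero => simpa using sq_mul_apply_self_le_of_rayleigh hB hρ hf
    | succ k ih =>
      simp only [hsucc] at ih ⊢
      exact sq_mul_apply_self_le_step hB hT ih
  induction k with
  | zero => simp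
  | succ k ih =>
    calc (ρ ^ (k + 1)) ^ 2 * B f f = ρ ^ 2 * ((ρ ^ k) ^ 2 * B f f) := by ring
      _ ≤ ρ ^ 2 * B ((T ^ k) f) ((T ^ k) f) := by gcongr
      _ ≤ _ := hstep k

end PosSemidefForms

section TotalVariation

variable {Ω : Type*} [Fintype Ω] {a b f : Ω → ℝ}

lemma abs_sub_dotProduct_le {M : ℝ} (hf : ∀ x, |f x| ≤ M) :
    |(a - b) ⬝ᵥ f| ≤ 2 * tvDist a b * M := by
  calc |(a - b) ⬝ᵥ f| ≤ ∑ x, |a x - b x| * M :=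
        (abs_sum_le_sum_abs _ _).trans (sum_le_sum fun x _ => by
          rw [abs_mul]; exact mul_le_mul_of_nonneg_left (hf x) (abs_nonneg _))
    _ = 2 * tvDist a b * M := by rw [← sum_mul, tvDist]; ring

lemma tvDist_le_one (ha : 0 ≤ a) (hb : 0 ≤ b) (ha1 : ∑ x, a x = 1) (hb1 : ∑ x, b x = 1) :
    tvDist a b ≤ 1 := by
  have habs : ∑ x, |a x - b x| ≤ ∑ x, (a x + b x) :=
    sum_le_sum fun x _ => (abs_sub _ _).trans_eq (by
      rw [abs_of_nonneg (ha x), abs_of_nonneg (hb x)])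
  rw [sum_add_distrib, ha1, hb1] at habs
  rw [tvDist]
  linarith

variable {P : Matrix Ω Ω ℝ}

lemma abs_mulVec_le {ε : ℝ} (hd : ∀ x, tvDist (P x) b ≤ ε) (hf : b ⬝ᵥ f = 0) {M : ℝ}
    (hM : ∀ x, |f x| ≤ M) (x : Ω) : |(P *ᵥ f) x| ≤ 2 * ε * M := by
  have hM0 : 0 ≤ M := (abs_nonneg _).trans (hM x)
  calc |(P *ᵥ f) x| = |(P x - b) ⬝ᵥ f| := by rw [sub_dotProduct, hf, sub_zero, mulVec]
    _ ≤ 2 * tvDist (P x) b * M := abs_sub_dotProduct_le hM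
    _ ≤ 2 * ε * M := by gcongr; exact hd x

lemma tvDist_vecMul_le_sum_mul (ha : 0 ≤ a) (ha1 : ∑ x, a x = 1) :
    tvDist (a ᵥ* P) b ≤ ∑ x, a x * tvDist (P x) b := by
  have habs (z : Ω) : |(a ᵥ* P) z - b z| ≤ ∑ x, a x * |P x z - b z| := by
    have hmix : (a ᵥ* P) z - b z = ∑ x, a x * (P x z - b z) := by
      simp only [mul_sub, sum_sub_distrib, ← sum_mul, ha1, one_mul, vecMul, dotProduct]
    rw [hmix]
    exact (abs_sum_le_sum_abs _ _).trans_eq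
      (sum_congr rfl fun x _ => by rw [abs_mul, abs_of_nonneg (ha x)])
  calc tvDist (a ᵥ* P) b ≤ 1 / 2 * ∑ z, ∑ x, a x * |P x z - b z| :=
        mul_le_mul_of_nonneg_left (sum_le_sum fun z _ => habs z) (by norm_num)
    _ = ∑ x, a x * tvDist (P x) b := by
        rw [sum_comm, mul_sum]
        exact sum_congr rfl fun x _ => by rw [tvDist, ← mul_sum]; ring

variable [DecidableEq Ω]

lemma tvDist_vecMul_le (hP : P ∈ rowStochastic ℝ Ω) :
    tvDist (a ᵥ* P) (b ᵥ* P) ≤ tvDist a b := by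
  refine mul_le_mul_of_nonneg_left ?_ (by norm_num)
  calc ∑ y, |(a ᵥ* P) y - (b ᵥ* P) y| ≤ ∑ y, ∑ x, |a x - b x| * P x y := by
        refine sum_le_sum fun y _ => ?_
        rw [← Pi.sub_apply, ← sub_vecMul]
        exact (abs_sum_le_sum_abs _ _).trans_eq (sum_congr rfl fun x _ => by
          rw [abs_mul, abs_of_nonneg (nonneg_of_mem_rowStochastic hP), Pi.sub_apply])
    _ = ∑ x, |a x - b x| := by
        rw [sum_comm]
        exact sum_congr rfl fun x _ => by
          rw [← mul_sum, sum_row_of_mem_rowStochastic hP, mul_one]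

lemma mixingTime_le {ε : ℝ} {t : ℕ} (ht : ∀ x, tvDist ((P ^ t) x) b ≤ ε) :
    mixingTime P b ε ≤ t :=
  iSup_le fun x => iInf₂_le t (ht x)

lemma mixingTime_eq_zero_of_subsingleton [Subsingleton Ω] (hb1 : ∑ x, b x = 1) {ε : ℝ}
    (hε : 0 ≤ ε) : mixingTime P b ε = 0 := by
  refine nonpos_iff_eq_zero.1 (mixingTime_le fun x => ?_)
  have hbx : b x = 1 := by rwa [Fintype.sum_subsingleton _ x] at hb1
  simpa [tvDist, Fintype.sum_subsingleton _ x, hbx] using hε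

end TotalVariation

section WeightedInner

variable {Ω : Type*} [Fintype Ω]

/-- The inner product of `L²(w)`, for a weight `w` on a finite set. -/
def weightedInner (w : Ω → ℝ) : LinearMap.BilinForm ℝ (Ω → ℝ) :=
  LinearMap.mk₂ ℝ (fun f g => ∑ x, w x * f x * g x)
    (fun _ _ _ => by simp only [Pi.add_apply, mul_add, add_mul, sum_add_distrib])
    (fun _ _ _ => by
      simp only [Pi.smul_apply, smul_eq_mul, mul_sum]; exact sum_congr rfl fun _ _ => by ring)
    (fun _ _ _ => by simp only [Pi.add_apply, mul_add, sum_add_distrib])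
    (fun _ _ _ => by
      simp only [Pi.smul_apply, smul_eq_mul, mul_sum]; exact sum_congr rfl fun _ _ => by ring)

variable {w : Ω → ℝ}

lemma weightedInner_apply (f g : Ω → ℝ) : weightedInner w f g = ∑ x, w x * f x * g x := rfl

lemma weightedInner_isPosSemidef (hw : 0 ≤ w) : (weightedInner w).IsPosSemidef where
  eq f g := sum_congr rfl fun _ _ => mul_right_comm _ _ _
  nonneg f := sum_nonneg fun x _ => by
    rw [mul_assoc]; exact mul_nonneg (hw x) (mul_self_nonneg _)

lemma weightedInner_self_le_sq (hw : 0 ≤ w) (hw1 : ∑ x, w x = 1) {f : Ω → ℝ} {M : ℝ}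
    (hf : ∀ x, |f x| ≤ M) : weightedInner w f f ≤ M ^ 2 := by
  calc weightedInner w f f ≤ ∑ x, w x * M ^ 2 := sum_le_sum fun x _ => by
        rw [mul_assoc, ← sq]
        exact mul_le_mul_of_nonneg_left (sq_le_sq' (abs_le.1 (hf x)).1 (abs_le.1 (hf x)).2) (hw x)
    _ = M ^ 2 := by rw [← sum_mul, hw1, one_mul]

lemma sq_sum_mul_abs_le (hw : 0 ≤ w) (hw1 : ∑ x, w x = 1) (f : Ω → ℝ) :
    (∑ x, w x * |f x|) ^ 2 ≤ weightedInner w f f := by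
  have h := sq_apply_le (weightedInner_isPosSemidef hw) 1 |f|
  simpa [weightedInner_apply, hw1, mul_assoc, abs_mul_abs_self] using h

end WeightedInner

section ReversibleChain

variable {Ω : Type*} [Fintype Ω] [DecidableEq Ω]

/-- `P` is the transition matrix of a Markov chain that is reversible with respect to the
probability distribution `w` of full support. Detailed balance is stated as self-adjointness
on `L²(w)`. -/
structure IsReversibleChain (w : Ω → ℝ) (P : Matrix Ω Ω ℝ) : Prop where
  pos : ∀ x, 0 < w x
  sum_eq_one : ∑ x, w x = 1
  mem_rowStochastic : P ∈ rowStochastic ℝ Ω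
  isSelfAdjoint : (weightedInner w).IsSelfAdjoint (toLin' P)

/-- The Poincaré inequality with constant `γ`: the spectral gap of the reversible chain `P` is at
least `γ`. -/
def PoincareInequality (w : Ω → ℝ) (P : Matrix Ω Ω ℝ) (γ : ℝ) : Prop :=
  ∀ f : Ω → ℝ, w ⬝ᵥ f = 0 → γ * weightedInner w f f ≤ weightedInner w f (f - P *ᵥ f)

namespace IsReversibleChain

variable {w : Ω → ℝ} {P : Matrix Ω Ω ℝ}

lemma nonneg (h : IsReversibleChain w P) : 0 ≤ w := fun x => (h.pos x).le

lemma isPosSemidef (h : IsReversibleChain w P) : (weightedInner w).IsPosSemidef :=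
  weightedInner_isPosSemidef h.nonneg

lemma pow (h : IsReversibleChain w P) (k : ℕ) : IsReversibleChain w (P ^ k) where
  pos := h.pos
  sum_eq_one := h.sum_eq_one
  mem_rowStochastic := pow_mem h.mem_rowStochastic k
  isSelfAdjoint := by
    rw [toLin'_pow]
    induction k with
    | zero => exact LinearMap.isAdjointPair_one
    | succ k ih =>
      have hmul := ih.mul h.isSelfAdjoint
      rwa [← pow_succ, ← pow_succ'] at hmul

lemma mul_apply_comm (h : IsReversibleChain w P) (x y : Ω) : w x * P x y = w y * P y x := by
  have hxy := h.isSelfAdjoint (Pi.single y 1) (Pi.single x 1)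
  simpa [weightedInner_apply, Pi.single_apply] using hxy

lemma vecMul_eq (h : IsReversibleChain w P) : w ᵥ* P = w := by
  funext y
  simp only [vecMul, dotProduct, h.mul_apply_comm _ y, ← mul_sum,
    sum_row_of_mem_rowStochastic h.mem_rowStochastic, mul_one]

lemma dotProduct_mulVec (h : IsReversibleChain w P) (f : Ω → ℝ) : w ⬝ᵥ P *ᵥ f = w ⬝ᵥ f := by
  rw [Matrix.dotProduct_mulVec, h.vecMul_eq]

lemma row_nonneg (h : IsReversibleChain w P) (x : Ω) : 0 ≤ P x :=
  fun _ => nonneg_of_mem_rowStochastic h.mem_rowStochastic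

lemma sum_row (h : IsReversibleChain w P) (x : Ω) : ∑ y, P x y = 1 :=
  sum_row_of_mem_rowStochastic h.mem_rowStochastic x

lemma tvDist_pow_antitone (h : IsReversibleChain w P) (x : Ω) :
    Antitone fun t : ℕ => tvDist ((P ^ t) x) w := by
  refine antitone_nat_of_succ_le fun t => ?_
  have hle := tvDist_vecMul_le (a := (P ^ t) x) (b := w) h.mem_rowStochastic
  rwa [h.vecMul_eq, ← mul_apply_eq_vecMul, ← pow_succ] at hle

lemma tvDist_le_of_mixingTime_le (h : IsReversibleChain w P) {ε : ℝ} {t : ℕ}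
    (ht : mixingTime P w ε ≤ t) (x : Ω) : tvDist ((P ^ t) x) w ≤ ε := by
  have hlt : (⨅ (s : ℕ) (_ : tvDist ((P ^ s) x) w ≤ ε), (s : ℕ∞)) < (t + 1 : ℕ) :=
    (iSup_le_iff.1 ht x).trans_lt (by exact_mod_cast Nat.lt_succ_self t)
  simp only [iInf_lt_iff, Nat.cast_lt, Nat.lt_succ_iff] at hlt
  obtain ⟨s, hs, hst⟩ := hlt
  exact (h.tvDist_pow_antitone x hst).trans hs

lemma tvDist_one_row (h : IsReversibleChain w P) (x : Ω) :
    tvDist ((1 : Matrix Ω Ω ℝ) x) w = 1 - w x := by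
  have hx : w x ≤ 1 := h.sum_eq_one ▸ single_le_sum (fun y _ => h.nonneg y) (mem_univ x)
  have hrest : ∑ y ∈ univ.erase x, |(1 : Matrix Ω Ω ℝ) x y - w y| = ∑ y ∈ univ.erase x, w y :=
    sum_congr rfl fun y hy => by
      rw [one_apply_ne (ne_of_mem_erase hy).symm, zero_sub, abs_neg, abs_of_pos (h.pos y)]
  have hsum := add_sum_erase univ w (mem_univ x)
  rw [h.sum_eq_one] at hsum
  rw [tvDist, ← add_sum_erase _ _ (mem_univ x), hrest, one_apply_eq, abs_of_nonneg (by linarith)]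
  linarith

lemma mixingTime_ne_zero [Nontrivial Ω] (h : IsReversibleChain w P) {ε : ℝ} (hε : ε < 1 / 2) :
    mixingTime P w ε ≠ 0 := by
  intro hzero
  have hlarge (x : Ω) : 1 - ε ≤ w x := by
    have hx := h.tvDist_le_of_mixingTime_le (t := 0) hzero.le x
    rw [pow_zero, h.tvDist_one_row] at hx
    linarith
  obtain ⟨x, y, hxy⟩ := exists_pair_ne Ω
  have hpair : w x + w y ≤ 1 := by
    rw [← h.sum_eq_one, ← sum_pair hxy]
    exact sum_le_sum_of_subset_of_nonneg (subset_univ _) fun z _ _ => h.nonneg z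
  linarith [hlarge x, hlarge y]

lemma tvDist_pow_add_le (h : IsReversibleChain w P) (good : Ω → Prop) [DecidablePred good]
    {s t : ℕ} {δ ε : ℝ} (hε : 0 ≤ ε) {x : Ω} (hbad : ∑ y with ¬ good y, (P ^ s) x y ≤ δ)
    (hgood : ∀ y, good y → tvDist ((P ^ t) y) w ≤ ε) :
    tvDist ((P ^ (s + t)) x) w ≤ δ + ε := by
  have hs := h.pow s
  have ht := h.pow t
  calc tvDist ((P ^ (s + t)) x) w ≤ ∑ y, (P ^ s) x y * tvDist ((P ^ t) y) w := by
        rw [pow_add, mul_apply_eq_vecMul]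
        exact tvDist_vecMul_le_sum_mul (hs.row_nonneg x) (hs.sum_row x)
    _ = ∑ y with ¬ good y, (P ^ s) x y * tvDist ((P ^ t) y) w
        + ∑ y with good y, (P ^ s) x y * tvDist ((P ^ t) y) w :=
        by rw [sum_filter_not_add_sum_filter]
    _ ≤ ∑ y with ¬ good y, (P ^ s) x y + ∑ y with good y, (P ^ s) x y * ε := by
        refine add_le_add (sum_le_sum fun y _ => ?_) (sum_le_sum fun y hy => ?_)
        · exact mul_le_of_le_one_right (hs.row_nonneg x y)
            (tvDist_le_one (ht.row_nonneg y) h.nonneg (ht.sum_row y) h.sum_eq_one)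
        · exact mul_le_mul_of_nonneg_left (hgood y (mem_filter.1 hy).2) (hs.row_nonneg x y)
    _ ≤ δ + 1 * ε := by
        rw [← sum_mul, ← hs.sum_row x]
        gcongr
        exacts [fun y _ _ => hs.row_nonneg x y, filter_subset _ _]
    _ = δ + ε := by rw [one_mul]

lemma abs_pow_mulVec_le (h : IsReversibleChain w P) {ε : ℝ} (hd : ∀ x, tvDist (P x) w ≤ ε)
    {f : Ω → ℝ} (hf : w ⬝ᵥ f = 0) {M : ℝ} (hM : ∀ x, |f x| ≤ M) (k : ℕ) (x : Ω) :
    |(P ^ k *ᵥ f) x| ≤ (2 * ε) ^ k * M := by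
  induction k generalizing x with
  | zero => simpa using hM x
  | succ k ih =>
    rw [pow_succ', ← mulVec_mulVec, pow_succ', mul_assoc]
    exact abs_mulVec_le hd (((h.pow k).dotProduct_mulVec f).trans hf) ih x

end IsReversibleChain

lemma le_of_forall_mul_pow_le_mul_pow {c C a b : ℝ} (hc : 0 < c) (hb : 0 ≤ b)
    (h : ∀ k : ℕ, c * a ^ k ≤ C * b ^ k) : a ≤ b := by
  by_contra! hba
  have ha : 0 < a := hb.trans_lt hba
  rcases hb.eq_or_lt with rfl | hb
  · have := h 1
    nlinarith
  · obtain ⟨k, hk⟩ := pow_unbounded_of_one_lt (C / c) ((one_lt_div hb).2 hba)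
    rw [div_pow, div_lt_div_iff₀ hc (pow_pos hb k)] at hk
    linarith [h k]

namespace IsReversibleChain

variable {w : Ω → ℝ} {P : Matrix Ω Ω ℝ}

/-- Total variation distance `ε` to stationarity means that `P ^ t` contracts the sup norm of
mean-zero functions by `2ε`; iterating this beats the growth of any larger Rayleigh quotient. -/
lemma pow_rayleigh_le (h : IsReversibleChain w P) {t : ℕ} {ε : ℝ} (hε : 0 ≤ ε)
    (hd : ∀ x, tvDist ((P ^ t) x) w ≤ ε) {f : Ω → ℝ} (hf : w ⬝ᵥ f = 0)
    (hff : 0 < weightedInner w f f) {ρ : ℝ} (hρ : 0 ≤ ρ)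
    (hfρ : ρ * weightedInner w f f ≤ weightedInner w f (P *ᵥ f)) : ρ ^ t ≤ 2 * ε := by
  obtain ⟨M, hM⟩ : ∃ M, ∀ x, |f x| ≤ M := by
    obtain ⟨M, hM⟩ := (Set.finite_range fun x => |f x|).bddAbove
    exact ⟨M, fun x => hM ⟨x, rfl⟩⟩
  refine le_of_sq_le_sq ?_ (by positivity)
  refine le_of_forall_mul_pow_le_mul_pow hff (C := M ^ 2) (sq_nonneg _) fun k => ?_
  calc weightedInner w f f * ((ρ ^ t) ^ 2) ^ k
      = (ρ ^ (t * k)) ^ 2 * weightedInner w f f := by ring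
    _ ≤ weightedInner w ((toLin' P ^ (t * k)) f) ((toLin' P ^ (t * k)) f) :=
        pow_mul_apply_self_le_of_rayleigh h.isPosSemidef h.isSelfAdjoint hρ hfρ _
    _ = weightedInner w ((P ^ t) ^ k *ᵥ f) ((P ^ t) ^ k *ᵥ f) := by
        rw [← toLin'_pow, toLin'_apply, pow_mul]
    _ ≤ ((2 * ε) ^ k * M) ^ 2 :=
        weightedInner_self_le_sq h.nonneg h.sum_eq_one ((h.pow t).abs_pow_mulVec_le hd hf hM k)
    _ = M ^ 2 * ((2 * ε) ^ 2) ^ k := by rw [mul_pow, pow_right_comm, mul_comm]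

lemma poincareInequality_of_tvDist_le (h : IsReversibleChain w P) {t : ℕ} (ht : t ≠ 0)
    (hd : ∀ x, tvDist ((P ^ t) x) w ≤ 1 / 4) : PoincareInequality w P (1 / (2 * t)) := by
  intro f hf
  have ht1 : (1 : ℝ) ≤ t := by exact_mod_cast Nat.one_le_iff_ne_zero.2 ht
  have hγ : 1 / (2 * (t : ℝ)) ≤ 1 / 2 := one_div_le_one_div_of_le (by norm_num) (by linarith)
  rw [map_sub]
  by_contra! hlt
  have hff : 0 < weightedInner w f f := by
    refine (h.isPosSemidef.nonneg f).lt_of_ne fun h0 => ?_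
    have hcs := sq_apply_le h.isPosSemidef f (P *ᵥ f)
    rw [← h0, zero_mul] at hcs
    rw [← h0, sq_eq_zero_iff.1 (hcs.antisymm (sq_nonneg _))] at hlt
    simp at hlt
  set ρ := weightedInner w f (P *ᵥ f) / weightedInner w f f with hρ
  have hγρ : 1 - 1 / (2 * (t : ℝ)) < ρ := by rw [hρ, lt_div_iff₀ hff]; linarith
  have hbernoulli : (1 : ℝ) / 2 ≤ (1 - 1 / (2 * (t : ℝ))) ^ t := by
    refine le_trans (le_of_eq ?_) (one_add_mul_sub_le_pow (by linarith) t)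
    field_simp
    ring
  have hρt : ρ ^ t ≤ 2 * (1 / 4) :=
    h.pow_rayleigh_le (by norm_num) hd hf hff (by linarith) (div_mul_cancel₀ _ hff.ne').le
  linarith [pow_lt_pow_left₀ hγρ (by linarith) ht]

/-- The density of the point mass at `x` with respect to `w`, minus its mean `1`. -/
def centeredDensity (w : Ω → ℝ) (x : Ω) : Ω → ℝ := Pi.single x (1 / w x) - 1

lemma dotProduct_centeredDensity (h : IsReversibleChain w P) (x : Ω) :
    w ⬝ᵥ centeredDensity w x = 0 := by
  rw [centeredDensity, dotProduct_sub, dotProduct_single, dotProduct_one, h.sum_eq_one,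
    mul_one_div_cancel (h.pos x).ne', sub_self]

lemma weightedInner_centeredDensity_le (h : IsReversibleChain w P) (x : Ω) :
    weightedInner w (centeredDensity w x) (centeredDensity w x) ≤ 1 / w x := by
  have hx := (h.pos x).ne'
  have heq : weightedInner w (centeredDensity w x) (centeredDensity w x) = 1 / w x - 1 := by
    have hmean := h.dotProduct_centeredDensity x
    have hone : weightedInner w (centeredDensity w x) 1 = w ⬝ᵥ centeredDensity w x := by
      simp [weightedInner_apply, dotProduct]
    have hsingle : weightedInner w (centeredDensity w x) (Pi.single x (1 / w x))
        = w x * centeredDensity w x x * (1 / w x) := by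
      simp [weightedInner_apply, Pi.single_apply]
    have hval : centeredDensity w x x = 1 / w x - 1 := by simp [centeredDensity]
    nth_rewrite 2 [centeredDensity]
    rw [map_sub, hone, hmean, hsingle, hval]
    field_simp
    ring
  linarith

lemma mul_mulVec_centeredDensity (h : IsReversibleChain w P) (x y : Ω) :
    w y * (P *ᵥ centeredDensity w x) y = P x y - w y := by
  have hval : (P *ᵥ centeredDensity w x) y = P y x * (1 / w x) - 1 := by
    rw [centeredDensity, mulVec_sub, one_vecMul_of_mem_rowStochastic h.mem_rowStochastic,
      mulVec_single, Pi.sub_apply]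
    simp
  have hx := (h.pos x).ne'
  rw [hval, mul_sub, ← mul_assoc, ← h.mul_apply_comm x y]
  field_simp

lemma sq_tvDist_le (h : IsReversibleChain w P) (x : Ω) :
    (2 * tvDist (P x) w) ^ 2
      ≤ weightedInner w (P *ᵥ centeredDensity w x) (P *ᵥ centeredDensity w x) := by
  have htv : 2 * tvDist (P x) w = ∑ y, w y * |(P *ᵥ centeredDensity w x) y| := by
    rw [tvDist, ← mul_assoc, show (2 : ℝ) * (1 / 2) = 1 by norm_num, one_mul]
    exact sum_congr rfl fun y _ => by
      rw [← h.mul_mulVec_centeredDensity, abs_mul, abs_of_pos (h.pos y)]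
  rw [htv]
  exact sq_sum_mul_abs_le h.nonneg h.sum_eq_one _

/-- For a nonnegative operator the spectral gap controls all eigenvalues, hence mixing. -/
lemma sq_tvDist_pow_le_of_poincareInequality (h : IsReversibleChain w P) {γ : ℝ}
    (hgap : PoincareInequality w P γ)
    (hP : ∀ f, weightedInner w (P *ᵥ f) (P *ᵥ f) ≤ weightedInner w f (P *ᵥ f)) (k : ℕ) (x : Ω) :
    (2 * tvDist ((P ^ k) x) w) ^ 2 ≤ Real.exp (-(γ * k)) / w x := by
  have hcontract {f : Ω → ℝ} (hf : w ⬝ᵥ f = 0) :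
      weightedInner w (P *ᵥ f) (P *ᵥ f) ≤ Real.exp (-γ) * weightedInner w f f := by
    have hexp : (1 - γ) * weightedInner w f f ≤ Real.exp (-γ) * weightedInner w f f :=
      mul_le_mul_of_nonneg_right (Real.one_sub_le_exp_neg γ) (h.isPosSemidef.nonneg f)
    have hγ := hgap f hf
    rw [map_sub] at hγ
    linarith [hP f]
  have hpow {f : Ω → ℝ} (hf : w ⬝ᵥ f = 0) :
      weightedInner w (P ^ k *ᵥ f) (P ^ k *ᵥ f) ≤ Real.exp (-γ) ^ k * weightedInner w f f := by
    induction k with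
    | zero => simp
    | succ k ih =>
      rw [pow_succ', ← mulVec_mulVec, pow_succ', mul_assoc]
      exact (hcontract (((h.pow k).dotProduct_mulVec f).trans hf)).trans (by gcongr)
  calc (2 * tvDist ((P ^ k) x) w) ^ 2 ≤ _ := (h.pow k).sq_tvDist_le x
    _ ≤ Real.exp (-γ) ^ k * _ := hpow (h.dotProduct_centeredDensity x)
    _ ≤ Real.exp (-γ) ^ k * (1 / w x) := by gcongr; exact h.weightedInner_centeredDensity_le x
    _ = Real.exp (-(γ * k)) / w x := by rw [← Real.exp_nat_mul]; ring_nf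

end IsReversibleChain

end ReversibleChain

section HeatBath

variable {E : Type*} [DecidableEq E]

/-- The heat-bath update of the single element `e`, as an operator on functions: `e` becomes
present with probability `r A`. -/
def siteUpdate (r : Finset E → ℝ) (e : E) : Module.End ℝ (Finset E → ℝ) where
  toFun f A := r A * f (insert e A) + (1 - r A) * f (A.erase e)
  map_add' f g := by funext A; simp only [Pi.add_apply]; ring
  map_smul' c f := by funext A; simp only [Pi.smul_apply, smul_eq_mul, RingHom.id_apply]; ring

lemma siteUpdate_apply (r : Finset E → ℝ) (e : E) (f : Finset E → ℝ) (A : Finset E) :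
    siteUpdate r e f A = r A * f (insert e A) + (1 - r A) * f (A.erase e) := rfl

lemma siteUpdate_isIdempotentElem {r : Finset E → ℝ} {e : E} (hins : ∀ A, r (insert e A) = r A)
    (hera : ∀ A, r (A.erase e) = r A) : IsIdempotentElem (siteUpdate r e) := by
  refine LinearMap.ext fun f => funext fun A => ?_
  have hA : insert e (A.erase e) = insert e A := by grind
  simp only [Module.End.mul_apply, siteUpdate_apply, hins, hera, insert_idem,
    erase_insert_eq_erase, erase_idem, hA]
  ring

lemma siteUpdate_const_commute (p : ℝ) (e e' : E) :
    Commute (siteUpdate (fun _ => p) e) (siteUpdate (fun _ => p) e') := by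
  rcases eq_or_ne e e' with rfl | hne
  · exact Commute.refl _
  refine LinearMap.ext fun f => funext fun A => ?_
  simp only [Module.End.mul_apply, siteUpdate_apply]
  rw [insert_comm e e', erase_right_comm (a := e) (b := e'), erase_insert_of_ne hne,
    erase_insert_of_ne hne.symm]
  ring

lemma siteUpdate_const_pairwise (p : ℝ) (D : Finset E) :
    (D : Set E).Pairwise (Function.onFun Commute (siteUpdate fun _ => p)) :=
  fun e _ e' _ _ => siteUpdate_const_commute p e e'

/-- The conditional probability, under the weight `w`, that `e` is present given the
configuration on the other elements. -/
def condProb (w : Finset E → ℝ) (e : E) (A : Finset E) : ℝ :=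
  w (insert e A) / (w (insert e A) + w (A.erase e))

section CondProb

variable {w : Finset E → ℝ}

lemma condProb_insert (e : E) (A : Finset E) : condProb w e (insert e A) = condProb w e A := by
  simp only [condProb, insert_idem, erase_insert_eq_erase]

lemma condProb_erase (e : E) (A : Finset E) : condProb w e (A.erase e) = condProb w e A := by
  have hA : insert e (A.erase e) = insert e A := by grind
  simp only [condProb, hA, erase_idem]

lemma condProb_nonneg (hw : 0 ≤ w) (e : E) (A : Finset E) : 0 ≤ condProb w e A :=
  div_nonneg (hw _) (add_nonneg (hw _) (hw _))

lemma condProb_le_one (hw : 0 ≤ w) (e : E) (A : Finset E) : condProb w e A ≤ 1 :=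
  div_le_one_of_le₀ (le_add_of_nonneg_right (hw _)) (add_nonneg (hw _) (hw _))

lemma mul_condProb (hw : ∀ A, 0 < w A) {e : E} {A : Finset E} (he : e ∉ A) :
    w A * condProb w e A = w (insert e A) * (1 - condProb w e A) := by
  have hpos : 0 < w (insert e A) + w A := add_pos (hw _) (hw _)
  rw [condProb, erase_eq_of_notMem he]
  field_simp
  ring

end CondProb

variable [Fintype E]

lemma sum_finset_eq_sum_notMem (e : E) (F : Finset E → ℝ) :
    ∑ A, F A = ∑ A with e ∉ A, (F A + F (insert e A)) := by
  rw [sum_add_distrib, ← sum_filter_add_sum_filter_not univ (fun A => e ∉ A)]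
  congr 1
  refine sum_nbij' (fun A => A.erase e) (fun A => insert e A) ?_ ?_ ?_ ?_ ?_ <;>
    simp +contextual [insert_erase]

section Reversible

variable {w r : Finset E → ℝ} {e : E}

lemma siteUpdate_isOrthProj (hins : ∀ A, r (insert e A) = r A)
    (hera : ∀ A, r (A.erase e) = r A)
    (hbal : ∀ A, e ∉ A → w A * r A = w (insert e A) * (1 - r A)) :
    IsOrthProj (weightedInner w) (siteUpdate r e) where
  isIdempotentElem := siteUpdate_isIdempotentElem hins hera
  isSelfAdjoint f g := by
    rw [weightedInner_apply, weightedInner_apply, sum_finset_eq_sum_notMem e,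
      sum_finset_eq_sum_notMem e]
    refine sum_congr rfl fun A hA => ?_
    have he : e ∉ A := (mem_filter.1 hA).2
    simp only [siteUpdate_apply, hins, insert_idem, erase_insert he, erase_eq_of_notMem he]
    linear_combination (f (insert e A) * g A - f A * g (insert e A)) * hbal A he

lemma weightedInner_sub_siteUpdate (hins : ∀ A, r (insert e A) = r A)
    (hbal : ∀ A, e ∉ A → w A * r A = w (insert e A) * (1 - r A)) (f : Finset E → ℝ) :
    weightedInner w f (f - siteUpdate r e f)
      = ∑ A with e ∉ A, w (insert e A) * (1 - r A) * (f (insert e A) - f A) ^ 2 := by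
  rw [weightedInner_apply, sum_finset_eq_sum_notMem e]
  refine sum_congr rfl fun A hA => ?_
  have he : e ∉ A := (mem_filter.1 hA).2
  simp only [Pi.sub_apply, siteUpdate_apply, hins, insert_idem, erase_insert he,
    erase_eq_of_notMem he]
  linear_combination (f A * f A - f A * f (insert e A)) * hbal A he

end Reversible

/-- The operator resampling all elements of `D` independently, each becoming present with
probability `p`. -/
def resample (p : ℝ) (D : Finset E) : Module.End ℝ (Finset E → ℝ) where
  toFun f A := ∑ B : Finset E,
    (if B \ D = A \ D then p ^ (B ∩ D).card * (1 - p) ^ (D \ B).card else 0) * f B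
  map_add' f g := by funext A; simp only [Pi.add_apply, mul_add, sum_add_distrib]
  map_smul' c f := by
    funext A; simp only [Pi.smul_apply, smul_eq_mul, RingHom.id_apply, mul_sum]
    exact sum_congr rfl fun _ _ => by ring

lemma resample_apply (p : ℝ) (D : Finset E) (f : Finset E → ℝ) (A : Finset E) :
    resample p D f A = ∑ B : Finset E,
      (if B \ D = A \ D then p ^ (B ∩ D).card * (1 - p) ^ (D \ B).card else 0) * f B := rfl

lemma resample_empty (p : ℝ) : resample p (∅ : Finset E) = 1 := by
  refine LinearMap.ext fun f => funext fun A => ?_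
  simp [resample_apply]

lemma resample_insert (p : ℝ) {e : E} {D : Finset E} (he : e ∉ D) :
    resample p (insert e D) = siteUpdate (fun _ => p) e * resample p D := by
  refine LinearMap.ext fun f => funext fun A => ?_
  simp only [Module.End.mul_apply, siteUpdate_apply, resample_apply, mul_sum]
  rw [← sum_add_distrib]
  refine sum_congr rfl fun B _ => ?_
  rw [← mul_assoc, ← mul_assoc, ← add_mul]
  congr 1
  by_cases hB : e ∈ B
  · have hagree : B \ insert e D = A \ insert e D ↔ B \ D = insert e A \ D := by
      simp only [Finset.ext_iff, mem_sdiff, mem_insert]; grind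
    have hne : B \ D ≠ A.erase e \ D :=
      ne_of_mem_of_not_mem' (a := e) (by grind) (by grind)
    rw [if_neg hne, mul_zero, add_zero, mul_ite, mul_zero]
    refine if_congr hagree ?_ rfl
    rw [inter_insert_of_mem hB, insert_sdiff_of_mem _ hB, card_insert_of_notMem (by simp [he])]
    ring
  · have hagree : B \ insert e D = A \ insert e D ↔ B \ D = A.erase e \ D := by
      simp only [Finset.ext_iff, mem_sdiff, mem_insert, mem_erase]; grind
    have hne : B \ D ≠ insert e A \ D :=
      (ne_of_mem_of_not_mem' (a := e) (by grind) (by grind)).symm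
    rw [if_neg hne, mul_zero, zero_add, mul_ite, mul_zero]
    refine if_congr hagree ?_ rfl
    rw [inter_insert_of_notMem hB, insert_sdiff_of_notMem _ hB,
      card_insert_of_notMem (by simp [he])]
    ring

lemma resample_eq_noncommProd (p : ℝ) (D : Finset E) : resample p D =
    D.noncommProd (siteUpdate fun _ => p) (siteUpdate_const_pairwise p D) := by
  induction D using Finset.induction_on with
  | empty => exact resample_empty p
  | insert e D he ih => rw [resample_insert p he, ih, noncommProd_insert_of_notMem _ _ _ _ he]

lemma resample_one (p : ℝ) (D : Finset E) : resample p D 1 = 1 := by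
  induction D using Finset.induction_on with
  | empty => rw [resample_empty, Module.End.one_apply]
  | insert e D he ih =>
    rw [resample_insert p he, Module.End.mul_apply, ih]
    funext A
    simp [siteUpdate_apply]

section Reversible

variable {w : Finset E → ℝ} {p : ℝ} {D : Finset E}

lemma resample_isOrthProj
    (hbal : ∀ e ∈ D, ∀ A, e ∉ A → w A * p = w (insert e A) * (1 - p)) :
    IsOrthProj (weightedInner w) (resample p D) := by
  rw [resample_eq_noncommProd]
  exact .noncommProd
    (fun e he => siteUpdate_isOrthProj (fun _ => rfl) (fun _ => rfl) (hbal e he)) _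

lemma weightedInner_sub_resample_le (hw : 0 ≤ w)
    (hbal : ∀ e ∈ D, ∀ A, e ∉ A → w A * p = w (insert e A) * (1 - p)) (f : Finset E → ℝ) :
    weightedInner w f (f - resample p D f)
      ≤ ∑ e ∈ D, ∑ A with e ∉ A, w (insert e A) * (1 - p) * (f (insert e A) - f A) ^ 2 := by
  rw [resample_eq_noncommProd]
  refine (IsOrthProj.apply_sub_noncommProd_self_le
    (fun e he => siteUpdate_isOrthProj (fun _ => rfl) (fun _ => rfl) (hbal e he)) _
    (weightedInner_isPosSemidef hw).isNonneg f).trans_eq (sum_congr rfl fun e he => ?_)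
  exact weightedInner_sub_siteUpdate (fun _ => rfl) (hbal e he) f

end Reversible

lemma sum_bernoulli {x y : ℝ} (h : x + y = 1) :
    ∑ S : Finset E, x ^ S.card * y ^ (Sᶜ).card = 1 := by
  simp only [card_compl]
  rw [Fintype.sum_pow_mul_eq_add_pow, h, one_pow]

lemma card_compl_eq_card_compl_insert_add_one {e : E} {S : Finset E} (he : e ∉ S) :
    (Sᶜ).card = ((insert e S)ᶜ).card + 1 := by
  rw [compl_insert, card_erase_add_one (mem_compl.2 he)]

lemma mul_bernoulli_insert (x y : ℝ) {e : E} {S : Finset E} (he : e ∉ S) :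
    y * (x ^ (insert e S).card * y ^ ((insert e S)ᶜ).card) = x * (x ^ S.card * y ^ (Sᶜ).card) := by
  rw [card_compl_eq_card_compl_insert_add_one he, card_insert_of_notMem he]
  ring

lemma sum_bernoulli_mem {x y : ℝ} (h : x + y = 1) (e : E) :
    ∑ S : Finset E with e ∈ S, x ^ S.card * y ^ (Sᶜ).card = x := by
  obtain rfl : y = 1 - x := by linarith
  have htotal := congrArg (x * ·) (sum_bernoulli (E := E) h)
  simp only [mul_one, sum_finset_eq_sum_notMem e, mul_sum] at htotal
  refine Eq.trans ?_ htotal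
  rw [sum_filter, sum_finset_eq_sum_notMem e]
  refine sum_congr rfl fun S hS => ?_
  have he : e ∉ S := (mem_filter.1 hS).2
  rw [if_neg he, if_pos (mem_insert_self _ _), card_compl_eq_card_compl_insert_add_one he,
    card_insert_of_notMem he]
  ring

end HeatBath

section Subgraph

variable {V : Type*} {G : SimpleGraph V}

lemma subgraphOf_adj {A : Config G} {u v : V} :
    (subgraphOf A).Adj u v ↔ ∃ e ∈ A, (e : Sym2 V) = s(u, v) := by
  rw [subgraphOf, SimpleGraph.fromEdgeSet_adj]
  constructor
  · rintro ⟨⟨e, he, heq⟩, -⟩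
    exact ⟨e, he, heq⟩
  · rintro ⟨e, he, heq⟩
    have hadj : G.Adj u v := by rw [← SimpleGraph.mem_edgeSet, ← heq]; exact e.2
    exact ⟨⟨e, he, heq⟩, hadj.ne⟩

lemma subgraphOf_mono {A B : Config G} (h : A ⊆ B) : subgraphOf A ≤ subgraphOf B := by
  intro u v
  rw [subgraphOf_adj, subgraphOf_adj]
  exact fun ⟨e, he, heq⟩ => ⟨e, h he, heq⟩

lemma numComponents_anti [Finite V] {A B : Config G} (h : A ⊆ B) :
    numComponents B ≤ numComponents A :=
  Nat.card_le_card_of_surjective _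
    (SimpleGraph.ConnectedComponent.surjective_map_ofLE (subgraphOf_mono h))

lemma numComponents_le [Fintype V] (A : Config G) : numComponents A ≤ Fintype.card V := by
  rw [← Nat.card_eq_fintype_card]
  exact Nat.card_le_card_of_surjective (subgraphOf A).connectedComponentMk Quot.mk_surjective

/-- `W` is a union of vertex sets of components of `(V, A)`, expressed by saying that no edge of
`A` leaves `W`. These are the possible sets of active vertices. -/
def IsUnionOfComponents (A : Config G) (W : Finset V) : Prop :=
  ∀ u v, (subgraphOf A).Adj u v → (u ∈ W ↔ v ∈ W)

lemma IsUnionOfComponents.mem_iff_of_reachable {A : Config G} {W : Finset V}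
    (hW : IsUnionOfComponents A W) {u v : V} (huv : (subgraphOf A).Reachable u v) :
    u ∈ W ↔ v ∈ W := by
  obtain ⟨walk⟩ := huv
  induction walk with
  | nil => rfl
  | cons hadj _ ih => exact (hW _ _ hadj).trans ih

section Insert

variable [DecidableEq V] {A : Config G} {W : Finset V} {e : G.edgeSet}

lemma isUnionOfComponents_insert (he : ∀ v ∈ (e : Sym2 V), v ∈ W) :
    IsUnionOfComponents (insert e A) W ↔ IsUnionOfComponents A W := by
  constructor
  · exact fun hW u v huv => hW u v (subgraphOf_mono (subset_insert _ _) huv)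
  · intro hW u v huv
    obtain ⟨e', he', heq⟩ := subgraphOf_adj.1 huv
    rcases mem_insert.1 he' with rfl | he'
    · rw [heq] at he
      simp only [he u (by simp), he v (by simp)]
    · exact hW u v (subgraphOf_adj.2 ⟨e', he', heq⟩)

lemma reachable_of_reachable_insert (he : ∀ v ∈ (e : Sym2 V), v ∈ W)
    (hW : IsUnionOfComponents A W) {u v : V} (hu : u ∉ W)
    (huv : (subgraphOf (insert e A)).Reachable u v) : (subgraphOf A).Reachable u v := by
  obtain ⟨walk⟩ := huv
  induction walk with
  | nil => exact SimpleGraph.Reachable.refl _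
  | @cons a b c hadj _ ih =>
    have hadjA : (subgraphOf A).Adj a b := by
      obtain ⟨e', he', heq⟩ := subgraphOf_adj.1 hadj
      rcases mem_insert.1 he' with rfl | he'
      · rw [heq] at he
        exact absurd (he a (by simp)) hu
      · exact subgraphOf_adj.2 ⟨e', he', heq⟩
    exact hadjA.reachable.trans (ih fun hb => hu ((hW _ _ hadjA).2 hb))

end Insert

end Subgraph

section Activation

variable {V : Type*} {G : SimpleGraph V}

open Classical in
/-- The number of components of `(V, A)` that meet `W`. -/
def numComponentsMeeting (A : Config G) (W : Finset V) : ℕ :=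
  (W.image (subgraphOf A).connectedComponentMk).card

lemma numComponentsMeeting_insert [DecidableEq V] {A : Config G} {U W : Finset V} {e : G.edgeSet}
    (he : ∀ v ∈ (e : Sym2 V), v ∈ W) (hW : IsUnionOfComponents A W) (hU : Disjoint U W) :
    numComponentsMeeting (insert e A) U = numComponentsMeeting A U := by
  classical
  have hle : subgraphOf A ≤ subgraphOf (insert e A) := subgraphOf_mono (subset_insert _ _)
  have himage : U.image (subgraphOf (insert e A)).connectedComponentMk
      = (U.image (subgraphOf A).connectedComponentMk).image
        (SimpleGraph.ConnectedComponent.map (SimpleGraph.Hom.ofLE hle)) := by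
    rw [image_image]; rfl
  rw [numComponentsMeeting, numComponentsMeeting, himage, card_image_of_injOn]
  intro c hc d hd hcd
  obtain ⟨u, hu, rfl⟩ := mem_image.1 hc
  obtain ⟨v, -, rfl⟩ := mem_image.1 hd
  exact SimpleGraph.ConnectedComponent.eq.2 (reachable_of_reachable_insert he hW
    (disjoint_left.1 hU hu) (SimpleGraph.ConnectedComponent.eq.1 hcd))

variable [Fintype V]

open Classical in
/-- The vertices in the components belonging to `S`. -/
def activeVerts (A : Config G) (S : Finset (Component A)) : Finset V :=
  univ.filter fun v => (subgraphOf A).connectedComponentMk v ∈ S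

section ActiveVerts

variable {A : Config G} {S : Finset (Component A)}

lemma mem_activeVerts {v : V} :
    v ∈ activeVerts A S ↔ (subgraphOf A).connectedComponentMk v ∈ S := by
  simp [activeVerts]

open Classical in
lemma image_activeVerts (A : Config G) (S : Finset (Component A)) :
    (activeVerts A S).image (subgraphOf A).connectedComponentMk = S := by
  ext c
  induction c using SimpleGraph.ConnectedComponent.ind with
  | h v =>
    simp only [mem_image, mem_activeVerts]
    exact ⟨fun ⟨_, hu, huv⟩ => huv ▸ hu, fun hv => ⟨v, hv, rfl⟩⟩

lemma isUnionOfComponents_activeVerts (A : Config G) (S : Finset (Component A)) :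
    IsUnionOfComponents A (activeVerts A S) := by
  intro u v huv
  rw [mem_activeVerts, mem_activeVerts, SimpleGraph.ConnectedComponent.eq.2 huv.reachable]

open Classical in
lemma activeVerts_image {W : Finset V} (hW : IsUnionOfComponents A W) :
    activeVerts A (W.image (subgraphOf A).connectedComponentMk) = W := by
  ext v
  rw [mem_activeVerts, mem_image]
  constructor
  · rintro ⟨u, hu, huv⟩
    exact (hW.mem_iff_of_reachable (SimpleGraph.ConnectedComponent.eq.1 huv)).1 hu
  · exact fun hv => ⟨v, hv, rfl⟩

lemma numComponentsMeeting_activeVerts (A : Config G) (S : Finset (Component A)) :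
    numComponentsMeeting A (activeVerts A S) = S.card := by
  rw [numComponentsMeeting, image_activeVerts]

variable [DecidableEq V]

open Classical in
lemma activeVerts_compl (A : Config G) (S : Finset (Component A)) :
    activeVerts A Sᶜ = (activeVerts A S)ᶜ := by
  ext v; simp [mem_activeVerts]

end ActiveVerts

variable [DecidableEq V]

lemma numComponentsMeeting_add_compl {A : Config G} {W : Finset V}
    (hW : IsUnionOfComponents A W) :
    numComponentsMeeting A W + numComponentsMeeting A Wᶜ = numComponents A := by
  classical
  rw [← activeVerts_image hW, ← activeVerts_compl, numComponentsMeeting_activeVerts,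
    numComponentsMeeting_activeVerts, card_add_card_compl, numComponents,
    Nat.card_eq_fintype_card]

open Classical in
/-- The probability that `W` is the set of active vertices when each component of `(V, A)` is
activated independently with probability `1 / q`. -/
def activeProb (q : ℝ) (A : Config G) (W : Finset V) : ℝ :=
  if IsUnionOfComponents A W then
    (1 / q) ^ numComponentsMeeting A W * (1 - 1 / q) ^ numComponentsMeeting A Wᶜ
  else 0

open Classical in
lemma sum_activation_mul_eq (q : ℝ) (A : Config G) (F : Finset V → ℝ) :
    ∑ S : Finset (Component A), (1 / q) ^ S.card * (1 - 1 / q) ^ (Sᶜ).card * F (activeVerts A S)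
      = ∑ W : Finset V, activeProb q A W * F W := by
  simp only [activeProb, ite_mul, zero_mul]
  rw [← sum_filter]
  refine sum_nbij' (activeVerts A) (fun W => W.image (subgraphOf A).connectedComponentMk)
    (fun S _ => mem_filter.2 ⟨mem_univ _, isUnionOfComponents_activeVerts A S⟩)
    (fun W _ => mem_univ _) (fun S _ => image_activeVerts A S)
    (fun W hW => activeVerts_image (mem_filter.1 hW).2) fun S _ => ?_
  rw [← activeVerts_compl, numComponentsMeeting_activeVerts, numComponentsMeeting_activeVerts]

lemma activeProb_nonneg {q : ℝ} (hq : 1 ≤ q) (A : Config G) (W : Finset V) :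
    0 ≤ activeProb q A W := by
  have hinactive : 0 ≤ 1 - 1 / q := sub_nonneg.2 (div_le_one_of_le₀ hq (by linarith))
  unfold activeProb
  split_ifs
  · positivity
  · exact le_rfl

lemma sum_activeProb (q : ℝ) (A : Config G) : ∑ W : Finset V, activeProb q A W = 1 := by
  classical
  have h := sum_activation_mul_eq q A 1
  simp only [Pi.one_apply, mul_one] at h
  rw [← h]
  exact sum_bernoulli (by ring)

/-- The factor `q ^ c(A)` of the random-cluster weight turns the activation probability `1 / q`
of each component in `W` into `1`, so only the components outside `W` contribute. -/
lemma pow_mul_activeProb {q : ℝ} (hq : q ≠ 0) {A : Config G} {W : Finset V}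
    (hW : IsUnionOfComponents A W) :
    q ^ numComponents A * activeProb q A W = (q - 1) ^ numComponentsMeeting A Wᶜ := by
  have hinactive : q - 1 = q * (1 - 1 / q) := by field_simp
  rw [activeProb, if_pos hW, ← numComponentsMeeting_add_compl hW, pow_add, mul_mul_mul_comm,
    ← mul_pow, mul_one_div_cancel hq, one_pow, one_mul, ← mul_pow, ← hinactive]

lemma pow_mul_activeProb_insert {q : ℝ} (hq : q ≠ 0) {A : Config G} {W : Finset V}
    {e : G.edgeSet} (he : ∀ v ∈ (e : Sym2 V), v ∈ W) :
    q ^ numComponents (insert e A) * activeProb q (insert e A) W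
      = q ^ numComponents A * activeProb q A W := by
  by_cases hW : IsUnionOfComponents A W
  · rw [pow_mul_activeProb hq hW, pow_mul_activeProb hq ((isUnionOfComponents_insert he).2 hW),
      numComponentsMeeting_insert he hW disjoint_compl_left]
  · simp only [activeProb, isUnionOfComponents_insert he, hW, if_false, mul_zero]

variable [DecidableRel G.Adj]

/-- The edges of `G` with both endpoints in `W`. -/
def edgesIn (G : SimpleGraph V) [DecidableRel G.Adj] (W : Finset V) : Config G :=
  univ.filter fun e => ∀ v ∈ (e : Sym2 V), v ∈ W

lemma mem_edgesIn {W : Finset V} {e : G.edgeSet} :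
    e ∈ edgesIn G W ↔ ∀ v ∈ (e : Sym2 V), v ∈ W := by simp [edgesIn]

lemma edgesIn_activeVerts (A : Config G) (S : Finset (Component A)) :
    edgesIn G (activeVerts A S) = activeEdges A S := by
  ext e
  simp [mem_edgesIn, mem_activeVerts, activeEdges]

lemma sum_activeProb_edgesIn (q : ℝ) {A : Config G} {e : G.edgeSet} (he : e ∈ A) :
    ∑ W : Finset V with e ∈ edgesIn G W, activeProb q A W = 1 / q := by
  classical
  obtain ⟨⟨u, v⟩, huv⟩ := e
  have hcomp : (subgraphOf A).connectedComponentMk u = (subgraphOf A).connectedComponentMk v :=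
    SimpleGraph.ConnectedComponent.eq.2 (subgraphOf_adj.2 ⟨_, he, rfl⟩ :
      (subgraphOf A).Adj u v).reachable
  have hactive (S : Finset (Component A)) : ⟨s(u, v), huv⟩ ∈ edgesIn G (activeVerts A S) ↔
      (subgraphOf A).connectedComponentMk u ∈ S := by
    simp [mem_edgesIn, mem_activeVerts, ← hcomp]
  have h := sum_activation_mul_eq q A fun W => if ⟨s(u, v), huv⟩ ∈ edgesIn G W then 1 else 0
  simp only [hactive, mul_ite, mul_one, mul_zero, ← sum_filter] at h
  exact h.symm.trans (sum_bernoulli_mem (by ring) _)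

end Activation

section Measure

variable {V : Type*} [Fintype V] [DecidableEq V] (G : SimpleGraph V) [DecidableRel G.Adj] {p q : ℝ}

variable {G} in
lemma weight_pos (hq : 0 < q) (hp0 : 0 < p) (hp1 : p < 1) (A : Config G) : 0 < weight p q A := by
  have : 0 < 1 - p := sub_pos.2 hp1
  unfold weight
  positivity

lemma partitionFunction_pos (hq : 0 < q) (hp0 : 0 < p) (hp1 : p < 1) :
    0 < partitionFunction G p q :=
  sum_pos (fun A _ => weight_pos hq hp0 hp1 A) univ_nonempty

lemma rcMeasure_pos (hq : 0 < q) (hp0 : 0 < p) (hp1 : p < 1) (A : Config G) :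
    0 < rcMeasure G p q A :=
  div_pos (weight_pos hq hp0 hp1 A) (partitionFunction_pos G hq hp0 hp1)

lemma sum_rcMeasure (hq : 0 < q) (hp0 : 0 < p) (hp1 : p < 1) :
    ∑ A : Config G, rcMeasure G p q A = 1 := by
  simp only [rcMeasure, ← sum_div]
  exact div_self (partitionFunction_pos G hq hp0 hp1).ne'

lemma partitionFunction_le (hq : 1 ≤ q) (hp0 : 0 < p) (hp1 : p < 1) :
    partitionFunction G p q ≤ q ^ Fintype.card V := by
  have : 0 < 1 - p := sub_pos.2 hp1
  calc partitionFunction G p q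
      ≤ ∑ A : Config G, p ^ A.card * (1 - p) ^ (Aᶜ).card * q ^ Fintype.card V :=
        sum_le_sum fun A _ => mul_le_mul_of_nonneg_left
          (pow_le_pow_right₀ hq (numComponents_le A)) (by positivity)
    _ = q ^ Fintype.card V := by rw [← sum_mul, sum_bernoulli (by ring), one_mul]

lemma le_rcMeasure (hq : 1 ≤ q) (hp0 : 0 < p) (hp1 : p < 1) (A : Config G) :
    p ^ A.card * (1 - p) ^ (Aᶜ).card / q ^ Fintype.card V ≤ rcMeasure G p q A := by
  have hq0 : 0 < q := zero_lt_one.trans_le hq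
  have : 0 < 1 - p := sub_pos.2 hp1
  exact div_le_div₀ (weight_pos hq0 hp0 hp1 A).le
    (le_mul_of_one_le_right (by positivity) (one_le_pow₀ hq))
    (partitionFunction_pos G hq0 hp0 hp1) (partitionFunction_le G hq hp0 hp1)

lemma mul_rcMeasure_insert_le (hq : 1 ≤ q) (hp0 : 0 < p) (hp1 : p < 1) {A : Config G}
    {e : G.edgeSet} (he : e ∉ A) :
    (1 - p) * rcMeasure G p q (insert e A) ≤ p * rcMeasure G p q A := by
  have : 0 < 1 - p := sub_pos.2 hp1
  have hZ := partitionFunction_pos G (zero_lt_one.trans_le hq) hp0 hp1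
  rw [rcMeasure, rcMeasure, ← mul_div_assoc, ← mul_div_assoc, div_le_div_iff_of_pos_right hZ,
    weight, weight, ← mul_assoc (1 - p) (_ * _), mul_bernoulli_insert p (1 - p) he,
    ← mul_assoc p (_ * _)]
  exact mul_le_mul_of_nonneg_left
    (pow_le_pow_right₀ hq (numComponents_anti (subset_insert _ _))) (by positivity)

lemma condProb_rcMeasure_le (hq : 1 ≤ q) (hp0 : 0 < p) (hp1 : p < 1) (e : G.edgeSet)
    (A : Config G) : condProb (rcMeasure G p q) e A ≤ p := by
  have hpos := rcMeasure_pos G (zero_lt_one.trans_le hq) hp0 hp1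
  have hins := mul_rcMeasure_insert_le G hq hp0 hp1 (notMem_erase e A)
  have hA : insert e (A.erase e) = insert e A := by grind
  rw [hA] at hins
  rw [condProb, div_le_iff₀ (add_pos (hpos _) (hpos _))]
  linarith

end Measure

section ChayesMachta

variable {V : Type*} [Fintype V] [DecidableEq V] (G : SimpleGraph V) [DecidableRel G.Adj] {p q : ℝ}

lemma chayesMachta_mulVec_apply (p q : ℝ) (f : Config G → ℝ) (A : Config G) :
    (chayesMachta G p q *ᵥ f) A
      = ∑ W : Finset V, activeProb q A W * resample p (edgesIn G W) f A := by
  classical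
  rw [← sum_activation_mul_eq]
  simp only [mulVec, dotProduct, chayesMachta, sum_mul]
  rw [sum_comm]
  refine sum_congr rfl fun S _ => ?_
  simp only [edgesIn_activeVerts, resample_apply, mul_sum, mul_assoc]

/-- The joint weight of a configuration `A` and a set `W` of active vertices, when `A` is drawn
from the random-cluster measure and its components are then activated. -/
def jointWeight (p q : ℝ) (W : Finset V) (A : Config G) : ℝ :=
  rcMeasure G p q A * activeProb q A W

lemma jointWeight_nonneg (hq : 1 ≤ q) (hp0 : 0 < p) (hp1 : p < 1) (W : Finset V) :
    0 ≤ jointWeight G p q W := fun A =>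
  mul_nonneg (rcMeasure_pos G (zero_lt_one.trans_le hq) hp0 hp1 A).le (activeProb_nonneg hq A W)

/-- Given the set `W` of active vertices, the edges inside `W` are independent of each other and
of the rest, each being present with probability `p`. -/
lemma jointWeight_mul_eq (hq : q ≠ 0) {W : Finset V} {e : G.edgeSet} (heW : e ∈ edgesIn G W)
    {A : Config G} (he : e ∉ A) :
    jointWeight G p q W A * p = jointWeight G p q W (insert e A) * (1 - p) := by
  have hactive := pow_mul_activeProb_insert hq (A := A) (mem_edgesIn.1 heW)
  have hbernoulli := mul_bernoulli_insert p (1 - p) he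
  unfold jointWeight rcMeasure weight
  linear_combination
    (-(q ^ numComponents A * activeProb q A W / partitionFunction G p q)) * hbernoulli
      - ((1 - p) * (p ^ (insert e A).card * (1 - p) ^ ((insert e A)ᶜ).card)
        / partitionFunction G p q) * hactive

lemma sum_weightedInner_jointWeight (f g : Config G → ℝ) :
    ∑ W : Finset V, weightedInner (jointWeight G p q W) f g
      = weightedInner (rcMeasure G p q) f g := by
  simp only [weightedInner_apply, jointWeight]
  rw [sum_comm]
  simp only [← sum_mul, ← mul_sum, sum_activeProb, mul_one]

lemma weightedInner_chayesMachta (f g : Config G → ℝ) :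
    weightedInner (rcMeasure G p q) f (chayesMachta G p q *ᵥ g)
      = ∑ W : Finset V, weightedInner (jointWeight G p q W) f (resample p (edgesIn G W) g) := by
  simp only [weightedInner_apply, jointWeight, chayesMachta_mulVec_apply, mul_sum]
  rw [sum_comm]
  exact sum_congr rfl fun W _ => sum_congr rfl fun A _ => by ring

lemma chayesMachta_nonneg (hq : 1 ≤ q) (hp0 : 0 < p) (hp1 : p < 1) (A B : Config G) :
    0 ≤ chayesMachta G p q A B := by
  have : 0 < 1 - p := sub_pos.2 hp1
  have hinactive : 0 ≤ 1 - 1 / q := sub_nonneg.2 (div_le_one_of_le₀ hq (by linarith))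
  refine sum_nonneg fun S _ => ?_
  split_ifs <;> positivity

lemma chayesMachta_mem_rowStochastic (hq : 1 ≤ q) (hp0 : 0 < p) (hp1 : p < 1) :
    chayesMachta G p q ∈ rowStochastic ℝ (Config G) := by
  refine mem_rowStochastic.2 ⟨chayesMachta_nonneg G hq hp0 hp1, funext fun A => ?_⟩
  simp only [chayesMachta_mulVec_apply, resample_one, Pi.one_apply, mul_one, sum_activeProb]

lemma chayesMachta_isReversibleChain (hq : 1 ≤ q) (hp0 : 0 < p) (hp1 : p < 1) :
    IsReversibleChain (rcMeasure G p q) (chayesMachta G p q) where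
  pos := rcMeasure_pos G (zero_lt_one.trans_le hq) hp0 hp1
  sum_eq_one := sum_rcMeasure G (zero_lt_one.trans_le hq) hp0 hp1
  mem_rowStochastic := chayesMachta_mem_rowStochastic G hq hp0 hp1
  isSelfAdjoint f g := by
    have hsymm (w : Config G → ℝ) (f g) : weightedInner w f g = weightedInner w g f :=
      sum_congr rfl fun _ _ => mul_right_comm _ _ _
    rw [hsymm, toLin'_apply, toLin'_apply, weightedInner_chayesMachta, weightedInner_chayesMachta]
    refine sum_congr rfl fun W _ => ?_
    rw [hsymm, (resample_isOrthProj fun e heW A he =>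
      jointWeight_mul_eq G (by linarith) heW he).isSelfAdjoint]

lemma weightedInner_sub_chayesMachta_le (hq : 1 ≤ q) (hp0 : 0 < p) (hp1 : p < 1)
    (f : Config G → ℝ) :
    weightedInner (rcMeasure G p q) f (f - chayesMachta G p q *ᵥ f)
      ≤ 1 / q * ∑ e : G.edgeSet, ∑ A : Config G with e ∉ A,
        rcMeasure G p q (insert e A) * (1 - p) * (f (insert e A) - f A) ^ 2 := by
  have hq0 : q ≠ 0 := by linarith
  calc weightedInner (rcMeasure G p q) f (f - chayesMachta G p q *ᵥ f)
      = ∑ W : Finset V, weightedInner (jointWeight G p q W) f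
          (f - resample p (edgesIn G W) f) := by
        simp only [map_sub, weightedInner_chayesMachta, sum_sub_distrib,
          sum_weightedInner_jointWeight]
    _ ≤ ∑ W : Finset V, ∑ e ∈ edgesIn G W, ∑ A : Config G with e ∉ A,
          jointWeight G p q W (insert e A) * (1 - p) * (f (insert e A) - f A) ^ 2 :=
        sum_le_sum fun W _ => weightedInner_sub_resample_le (jointWeight_nonneg G hq hp0 hp1 W)
          (fun e heW A he => jointWeight_mul_eq G hq0 heW he) f
    _ = ∑ e : G.edgeSet, ∑ A : Config G with e ∉ A,
          (∑ W : Finset V with e ∈ edgesIn G W, activeProb q (insert e A) W) *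
            (rcMeasure G p q (insert e A) * (1 - p) * (f (insert e A) - f A) ^ 2) := by
        rw [sum_comm' (t' := univ) (s' := fun e => univ.filter fun W => e ∈ edgesIn G W)
          (by simp)]
        refine sum_congr rfl fun e _ => ?_
        rw [sum_comm]
        refine sum_congr rfl fun A _ => ?_
        rw [sum_mul]
        exact sum_congr rfl fun W _ => by rw [jointWeight]; ring
    _ = _ := by simp only [sum_activeProb_edgesIn q (mem_insert_self _ _), mul_sum]

end ChayesMachta

section Glauber

variable {V : Type*} [Fintype V] [DecidableEq V] (G : SimpleGraph V) [DecidableRel G.Adj] {p q : ℝ}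

lemma toLin'_glauber (p q : ℝ) : toLin' (glauber G p q) = (1 / (Fintype.card G.edgeSet : ℝ)) •
    ∑ e : G.edgeSet, siteUpdate (condProb (rcMeasure G p q) e) e := by
  refine LinearMap.ext fun f => funext fun A => ?_
  simp only [toLin'_apply, mulVec, dotProduct, glauber, sum_mul, LinearMap.smul_apply,
    LinearMap.sum_apply, Pi.smul_apply, Finset.sum_apply, smul_eq_mul, mul_sum]
  rw [sum_comm]
  refine sum_congr rfl fun e _ => ?_
  simp only [mul_assoc, ← mul_sum, add_mul, sum_add_distrib, ite_mul, zero_mul, sum_ite_eq',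
    mem_univ, if_true]
  rfl

lemma siteUpdate_condProb_isOrthProj (hq : 0 < q) (hp0 : 0 < p) (hp1 : p < 1) (e : G.edgeSet) :
    IsOrthProj (weightedInner (rcMeasure G p q))
      (siteUpdate (condProb (rcMeasure G p q) e) e) :=
  siteUpdate_isOrthProj (condProb_insert e) (condProb_erase e)
    fun _ => mul_condProb (rcMeasure_pos G hq hp0 hp1)

lemma glauber_nonneg (hq : 0 < q) (hp0 : 0 < p) (hp1 : p < 1) (A B : Config G) :
    0 ≤ glauber G p q A B := by
  have hμ : 0 ≤ rcMeasure G p q := fun C => (rcMeasure_pos G hq hp0 hp1 C).le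
  refine sum_nonneg fun e _ => mul_nonneg (by positivity) (add_nonneg ?_ ?_)
  · exact ite_nonneg (condProb_nonneg hμ e A) le_rfl
  · exact ite_nonneg (sub_nonneg.2 (condProb_le_one hμ e A)) le_rfl

variable [Nonempty G.edgeSet]

lemma glauber_mem_rowStochastic (hq : 0 < q) (hp0 : 0 < p) (hp1 : p < 1) :
    glauber G p q ∈ rowStochastic ℝ (Config G) := by
  refine mem_rowStochastic.2 ⟨glauber_nonneg G hq hp0 hp1, ?_⟩
  rw [← toLin'_apply, toLin'_glauber]
  funext A
  simp [siteUpdate_apply]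

lemma glauber_isReversibleChain (hq : 0 < q) (hp0 : 0 < p) (hp1 : p < 1) :
    IsReversibleChain (rcMeasure G p q) (glauber G p q) where
  pos := rcMeasure_pos G hq hp0 hp1
  sum_eq_one := sum_rcMeasure G hq hp0 hp1
  mem_rowStochastic := glauber_mem_rowStochastic G hq hp0 hp1
  isSelfAdjoint f g := by
    simp only [toLin'_glauber, LinearMap.smul_apply, LinearMap.sum_apply, map_smul, map_sum,
      (siteUpdate_condProb_isOrthProj G hq hp0 hp1 _).isSelfAdjoint f g]

lemma glauber_mulVec_self_le (hq : 0 < q) (hp0 : 0 < p) (hp1 : p < 1) (f : Config G → ℝ) :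
    weightedInner (rcMeasure G p q) (glauber G p q *ᵥ f) (glauber G p q *ᵥ f)
      ≤ weightedInner (rcMeasure G p q) f (glauber G p q *ᵥ f) :=
  apply_average_self_le (glauber_isReversibleChain G hq hp0 hp1).isPosSemidef
    (siteUpdate_condProb_isOrthProj G hq hp0 hp1) (toLin'_glauber G p q) f

lemma weightedInner_sub_glauber (hq : 0 < q) (hp0 : 0 < p) (hp1 : p < 1) (f : Config G → ℝ) :
    weightedInner (rcMeasure G p q) f (f - glauber G p q *ᵥ f)
      = 1 / (Fintype.card G.edgeSet : ℝ) * ∑ e : G.edgeSet, ∑ A : Config G with e ∉ A,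
        rcMeasure G p q (insert e A) * (1 - condProb (rcMeasure G p q) e A)
          * (f (insert e A) - f A) ^ 2 := by
  have haverage : f - glauber G p q *ᵥ f = (1 / (Fintype.card G.edgeSet : ℝ)) •
      ∑ e : G.edgeSet, (f - siteUpdate (condProb (rcMeasure G p q) e) e f) := by
    rw [← toLin'_apply, toLin'_glauber, sum_sub_distrib, smul_sub, LinearMap.smul_apply,
      LinearMap.sum_apply, sum_const, card_univ, ← Nat.cast_smul_eq_nsmul ℝ, smul_smul,
      one_div_mul_cancel (by simp), one_smul]
  rw [haverage, map_smul, map_sum, smul_eq_mul]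
  simp only [weightedInner_sub_siteUpdate (condProb_insert _)
    fun _ => mul_condProb (rcMeasure_pos G hq hp0 hp1)]

lemma chayesMachta_dirichlet_le_glauber_dirichlet (hq : 1 ≤ q) (hp0 : 0 < p) (hp1 : p < 1)
    (f : Config G → ℝ) :
    q / Fintype.card G.edgeSet
        * weightedInner (rcMeasure G p q) f (f - chayesMachta G p q *ᵥ f)
      ≤ weightedInner (rcMeasure G p q) f (f - glauber G p q *ᵥ f) := by
  have hq0 : 0 < q := zero_lt_one.trans_le hq
  calc q / Fintype.card G.edgeSet
        * weightedInner (rcMeasure G p q) f (f - chayesMachta G p q *ᵥ f)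
      ≤ q / Fintype.card G.edgeSet * (1 / q * ∑ e : G.edgeSet, ∑ A : Config G with e ∉ A,
          rcMeasure G p q (insert e A) * (1 - p) * (f (insert e A) - f A) ^ 2) := by
        gcongr; exact weightedInner_sub_chayesMachta_le G hq hp0 hp1 f
    _ = 1 / (Fintype.card G.edgeSet : ℝ) * ∑ e : G.edgeSet, ∑ A : Config G with e ∉ A,
          rcMeasure G p q (insert e A) * (1 - p) * (f (insert e A) - f A) ^ 2 := by
        rw [← mul_assoc]; congr 1; field_simp
    _ ≤ weightedInner (rcMeasure G p q) f (f - glauber G p q *ᵥ f) := by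
        rw [weightedInner_sub_glauber G hq0 hp0 hp1]
        gcongr with e _ A _
        · exact (rcMeasure_pos G hq0 hp0 hp1 _).le
        · exact condProb_rcMeasure_le G hq hp0 hp1 e A

lemma glauber_poincareInequality (hq : 1 ≤ q) (hp0 : 0 < p) (hp1 : p < 1) {γ : ℝ}
    (hγ : PoincareInequality (rcMeasure G p q) (chayesMachta G p q) γ) :
    PoincareInequality (rcMeasure G p q) (glauber G p q) (q / Fintype.card G.edgeSet * γ) := by
  intro f hf
  rw [mul_assoc]
  exact (mul_le_mul_of_nonneg_left (hγ f hf) (by positivity)).trans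
    (chayesMachta_dirichlet_le_glauber_dirichlet G hq hp0 hp1 f)

end Glauber

section BurnIn

section Drift

variable {Ω : Type*} [Fintype Ω]

lemma pow_mulVec_le_of_drift [DecidableEq Ω] {P : Matrix Ω Ω ℝ} (hP : P ∈ rowStochastic ℝ Ω)
    {f : Ω → ℝ} {a c : ℝ} (ha : 0 ≤ a)
    (hdrift : ∀ x, (P *ᵥ f) x ≤ c + a * (f x - c)) (t : ℕ) (x : Ω) :
    (P ^ t *ᵥ f) x ≤ c + a ^ t * (f x - c) := by
  induction t generalizing x with
  | zero => simp
  | succ t ih =>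
    have hsum (b : ℝ) : ∑ y, P x y * b = b := by
      rw [← sum_mul, sum_row_of_mem_rowStochastic hP, one_mul]
    calc (P ^ (t + 1) *ᵥ f) x
        = ∑ y, P x y * (P ^ t *ᵥ f) y := by rw [pow_succ', ← mulVec_mulVec]; rfl
      _ ≤ ∑ y, P x y * (c + a ^ t * (f y - c)) :=
          sum_le_sum fun y _ => mul_le_mul_of_nonneg_left (ih y)
            (nonneg_of_mem_rowStochastic hP)
      _ = c + a ^ t * ((P *ᵥ f) x - c) := by
          simp only [mulVec, dotProduct, mul_add, mul_sub, sum_add_distrib, sum_sub_distrib,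
            mul_left_comm _ (a ^ t), ← mul_sum, hsum]
      _ ≤ c + a ^ t * (a * (f x - c)) := by
          gcongr
          linarith [hdrift x]
      _ = c + a ^ (t + 1) * (f x - c) := by ring

lemma sum_filter_le_div_of_sum_mul_le {w f : Ω → ℝ} (hw : 0 ≤ w) (hf : 0 ≤ f) {K b : ℝ} (hK : 0 < K)
    {bad : Ω → Prop} [DecidablePred bad] (hbad : ∀ x, bad x → K ≤ f x)
    (hmean : ∑ x, w x * f x ≤ b) : ∑ x with bad x, w x ≤ b / K := by
  rw [le_div_iff₀ hK, sum_mul]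
  calc ∑ x with bad x, w x * K
      ≤ ∑ x with bad x, w x * f x := sum_le_sum fun x hx =>
        mul_le_mul_of_nonneg_left (hbad x (mem_filter.1 hx).2) (hw x)
    _ ≤ ∑ x, w x * f x := sum_le_sum_of_subset_of_nonneg (filter_subset _ _)
        fun x _ _ => mul_nonneg (hw x) (hf x)
    _ ≤ b := hmean

lemma one_sub_inv_pow_mul_le {m : ℝ} (hm : 1 ≤ m) {c : ℝ} (hc : 0 < c) {t : ℕ}
    (ht : m * Real.log (c * m) ≤ t) : (1 - 1 / m) ^ t * m ≤ 1 / c := by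
  have hm0 : 0 < m := zero_lt_one.trans_le hm
  have hbase : 0 ≤ 1 - 1 / m := sub_nonneg.2 ((div_le_one hm0).2 hm)
  have hpow : (1 - 1 / m) ^ t ≤ 1 / (c * m) := by
    calc (1 - 1 / m) ^ t ≤ Real.exp (-(1 / m)) ^ t :=
          pow_le_pow_left₀ hbase (Real.one_sub_le_exp_neg _) t
      _ = Real.exp (-(t / m)) := by rw [← Real.exp_nat_mul]; congr 1; ring
      _ ≤ Real.exp (-Real.log (c * m)) := by
          gcongr
          rwa [le_div_iff₀' hm0]
      _ = 1 / (c * m) := by rw [Real.exp_neg, Real.exp_log (by positivity), one_div]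
  calc (1 - 1 / m) ^ t * m ≤ 1 / (c * m) * m := by gcongr
    _ = 1 / c := by field_simp

end Drift

variable {V : Type*} [Fintype V] [DecidableEq V] (G : SimpleGraph V) [DecidableRel G.Adj] {p q : ℝ}

lemma siteUpdate_card_le (hq : 1 ≤ q) (hp0 : 0 < p) (hp1 : p < 1) (e : G.edgeSet) (A : Config G) :
    siteUpdate (condProb (rcMeasure G p q) e) e (fun B => (B.card : ℝ)) A
      ≤ A.card - (if e ∈ A then 1 else 0) + p := by
  have hprob := condProb_rcMeasure_le G hq hp0 hp1 e A
  rw [siteUpdate_apply]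
  split_ifs with he
  · rw [insert_eq_of_mem he, ← card_erase_add_one he]
    push_cast
    linarith
  · rw [erase_eq_of_notMem he, card_insert_of_notMem he]
    push_cast
    linarith

variable [Nonempty G.edgeSet]

lemma glauber_mulVec_card_le (hq : 1 ≤ q) (hp0 : 0 < p) (hp1 : p < 1) (A : Config G) :
    (glauber G p q *ᵥ fun B => (B.card : ℝ)) A
      ≤ p * Fintype.card G.edgeSet
        + (1 - 1 / (Fintype.card G.edgeSet : ℝ)) * (A.card - p * Fintype.card G.edgeSet) := by
  have hm : (Fintype.card G.edgeSet : ℝ) ≠ 0 := by simp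
  rw [← toLin'_apply, toLin'_glauber, LinearMap.smul_apply, LinearMap.sum_apply, Pi.smul_apply,
    Finset.sum_apply, smul_eq_mul]
  calc 1 / (Fintype.card G.edgeSet : ℝ) *
        ∑ e, siteUpdate (condProb (rcMeasure G p q) e) e (fun B => (B.card : ℝ)) A
      ≤ 1 / (Fintype.card G.edgeSet : ℝ) *
        ∑ e : G.edgeSet, (A.card - (if e ∈ A then 1 else 0) + p) := by
        gcongr with e
        exact siteUpdate_card_le G hq hp0 hp1 e A
    _ = p * Fintype.card G.edgeSet
        + (1 - 1 / (Fintype.card G.edgeSet : ℝ)) * (A.card - p * Fintype.card G.edgeSet) := by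
        rw [sum_add_distrib, sum_sub_distrib, sum_const, sum_const, card_univ, sum_boole,
          filter_univ_mem]
        simp only [nsmul_eq_mul]
        field_simp
        ring

lemma glauber_pow_mulVec_card_le (hq : 1 ≤ q) (hp0 : 0 < p) (hp1 : p < 1) {t : ℕ}
    (ht : Fintype.card G.edgeSet * Real.log (16 * Fintype.card G.edgeSet) ≤ t) (A : Config G) :
    (glauber G p q ^ t *ᵥ fun B => (B.card : ℝ)) A
      ≤ p * Fintype.card G.edgeSet + 1 / 16 := by
  have hm : (1 : ℝ) ≤ Fintype.card G.edgeSet := by exact_mod_cast Fintype.card_pos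
  have ha : 0 ≤ 1 - 1 / (Fintype.card G.edgeSet : ℝ) :=
    sub_nonneg.2 (div_le_one_of_le₀ hm (by positivity))
  have hexcess : (A.card : ℝ) - p * Fintype.card G.edgeSet ≤ Fintype.card G.edgeSet := by
    have hA : (A.card : ℝ) ≤ Fintype.card G.edgeSet := by exact_mod_cast A.card_le_univ
    linarith [show 0 ≤ p * Fintype.card G.edgeSet by positivity]
  calc (glauber G p q ^ t *ᵥ fun B => (B.card : ℝ)) A
      ≤ p * Fintype.card G.edgeSet + (1 - 1 / (Fintype.card G.edgeSet : ℝ)) ^ t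
          * (A.card - p * Fintype.card G.edgeSet) :=
        pow_mulVec_le_of_drift (glauber_mem_rowStochastic G (zero_lt_one.trans_le hq) hp0 hp1) ha
          (glauber_mulVec_card_le G hq hp0 hp1) t A
    _ ≤ p * Fintype.card G.edgeSet + (1 - 1 / (Fintype.card G.edgeSet : ℝ)) ^ t
          * Fintype.card G.edgeSet := by gcongr
    _ ≤ p * Fintype.card G.edgeSet + 1 / 16 := by
        gcongr
        exact one_sub_inv_pow_mul_le hm (by norm_num) ht

lemma glauber_pow_card_gt_le (hq : 1 ≤ q) (hp0 : 0 < p) (hp1 : p < 1) {t : ℕ}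
    (ht : Fintype.card G.edgeSet * Real.log (16 * Fintype.card G.edgeSet) ≤ t) (A : Config G) :
    ∑ B : Config G with ¬ (B.card : ℝ) ≤ 16 * p * Fintype.card G.edgeSet,
      (glauber G p q ^ t) A B ≤ 1 / 8 := by
  have hpow := (glauber_isReversibleChain G (zero_lt_one.trans_le hq) hp0 hp1).pow t
  have hpm : 0 < 16 * p * Fintype.card G.edgeSet := by
    have : 0 < Fintype.card G.edgeSet := Fintype.card_pos
    positivity
  -- The size of a configuration is an integer, so exceeding `16 p m` also means being at least `1`.
  have hbad (B : Config G) (hB : ¬ (B.card : ℝ) ≤ 16 * p * Fintype.card G.edgeSet) :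
      max 1 (16 * p * Fintype.card G.edgeSet) ≤ (B.card : ℝ) := by
    rw [not_le] at hB
    exact max_le (by exact_mod_cast hpm.trans hB) hB.le
  calc ∑ B : Config G with ¬ (B.card : ℝ) ≤ 16 * p * Fintype.card G.edgeSet,
        (glauber G p q ^ t) A B
      ≤ (p * Fintype.card G.edgeSet + 1 / 16) / max 1 (16 * p * Fintype.card G.edgeSet) :=
        sum_filter_le_div_of_sum_mul_le (fun B => hpow.row_nonneg A B) (fun B => Nat.cast_nonneg _)
          (by positivity) hbad (glauber_pow_mulVec_card_le G hq hp0 hp1 ht A)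
    _ ≤ 1 / 8 := by
        rw [div_le_iff₀ (by positivity)]
        linarith [le_max_left 1 (16 * p * Fintype.card G.edgeSet),
          le_max_right 1 (16 * p * Fintype.card G.edgeSet)]

end BurnIn

section MixingTime

section Estimates

lemma neg_log_one_div_min_le {p x : ℝ} (hp0 : 0 < p) (hp1 : p < 1) (hx : min p (1 - p) ≤ x) :
    -Real.log (1 / min p (1 - p)) ≤ Real.log x := by
  rw [one_div, Real.log_inv, neg_neg]
  exact Real.log_le_log (lt_min hp0 (sub_pos.2 hp1)) hx

lemma one_half_le_log {x : ℝ} (hx : 2 ≤ x) : 1 / 2 ≤ Real.log x := by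
  linarith [Real.log_le_log zero_lt_two hx, Real.log_two_gt_d9]

lemma one_half_le_log_one_div_min {p : ℝ} (hp0 : 0 < p) (hp1 : p < 1) :
    1 / 2 ≤ Real.log (1 / min p (1 - p)) := by
  refine one_half_le_log ((le_div_iff₀ (lt_min hp0 (sub_pos.2 hp1))).2 ?_)
  linarith [min_le_left p (1 - p), min_le_right p (1 - p)]

lemma neg_mul_log_one_div_min_le {p : ℝ} (hp0 : 0 < p) (hp1 : p < 1) :
    -(4 * p * Real.log (1 / min p (1 - p))) ≤ Real.log (1 - p) := by
  have hp1' : 0 < 1 - p := sub_pos.2 hp1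
  have hL := one_half_le_log_one_div_min hp0 hp1
  rcases le_total p (1 / 2) with h | h
  · have hinv : (1 - p)⁻¹ ≤ 1 + 2 * p := by
      rw [inv_le_iff_one_le_mul₀ hp1']
      nlinarith
    nlinarith [Real.one_sub_inv_le_log_of_pos hp1']
  · nlinarith [neg_log_one_div_min_le hp0 hp1 (min_le_right p (1 - p))]

lemma exp_neg_le_pow_mul_pow {p : ℝ} (hp0 : 0 < p) (hp1 : p < 1) {k l : ℕ}
    (hk : (k : ℝ) ≤ 16 * p * (k + l)) :
    Real.exp (-(20 * p * (k + l) * Real.log (1 / min p (1 - p)))) ≤ p ^ k * (1 - p) ^ l := by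
  have : 0 < 1 - p := sub_pos.2 hp1
  set L := Real.log (1 / min p (1 - p))
  have hL : 0 ≤ L := by linarith [one_half_le_log_one_div_min hp0 hp1]
  have hk0 : (0 : ℝ) ≤ k := k.cast_nonneg
  have hpresent : k * -L ≤ k * Real.log p :=
    mul_le_mul_of_nonneg_left (neg_log_one_div_min_le hp0 hp1 (min_le_left _ _)) hk0
  have habsent : l * -(4 * p * L) ≤ l * Real.log (1 - p) :=
    mul_le_mul_of_nonneg_left (neg_mul_log_one_div_min_le hp0 hp1) l.cast_nonneg
  rw [← Real.exp_log (by positivity : 0 < p ^ k * (1 - p) ^ l), Real.exp_le_exp,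
    Real.log_mul (by positivity) (by positivity), Real.log_pow, Real.log_pow]
  linarith [mul_le_mul_of_nonneg_right hk hL, show 0 ≤ 4 * p * k * L by positivity]

lemma log_sixteen_le : Real.log 16 ≤ 3 := by
  rw [show (16 : ℝ) = 2 ^ 4 by norm_num, Real.log_pow]
  norm_num
  linarith [Real.log_two_lt_d9]

lemma ceil_add_ceil_le {m n τ p L : ℝ} (hm : 1 ≤ m) (hn : 2 ≤ n) (hmn : m ≤ n ^ 2) (hτ : 1 ≤ τ)
    (hp : 0 ≤ p) (hL : 0 ≤ L) :
    (⌈m * Real.log (16 * m)⌉₊ + ⌈2 * m * τ * (3 + n + 20 * p * m * L)⌉₊ : ℝ)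
      ≤ 100 * (m * n * Real.log n + p * m ^ 2 * Real.log n * L) * τ := by
  have hlogn := one_half_le_log hn
  have hlogm : Real.log (16 * m) ≤ 3 + 2 * Real.log n := by
    have hlog := Real.log_le_log (by linarith) hmn
    rw [Real.log_pow] at hlog
    rw [Real.log_mul (by norm_num) (by linarith)]
    push_cast at hlog
    linarith [log_sixteen_le]
  have hburnIn := Nat.ceil_lt_add_one
    (mul_nonneg (zero_le_one.trans hm) (Real.log_nonneg (by linarith : 1 ≤ 16 * m)))
  have hcontract := Nat.ceil_lt_add_one
    (show 0 ≤ 2 * m * τ * (3 + n + 20 * p * m * L) by positivity)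
  set l := Real.log n
  have hmτ : m ≤ m * τ := le_mul_of_one_le_right (by linarith) hτ
  have hmτ_le : m * τ ≤ m * τ * (n * l) :=
    le_mul_of_one_le_right (by linarith) (by nlinarith)
  have hmτn_le : m * τ * n ≤ 2 * (m * τ * (n * l)) := by
    linarith [mul_le_mul_of_nonneg_left hlogn (show 0 ≤ m * τ * n by positivity)]
  have hmlog_le : m * Real.log (16 * m) ≤ m * 3 + m * τ * (n * l) := by
    calc m * Real.log (16 * m) ≤ m * (3 + 2 * l) := by gcongr
      _ = m * 3 + m * (2 * l) := by ring
      _ ≤ m * 3 + m * τ * (n * l) := by gcongr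
  have hpmL_le : m * τ * (p * m * L) ≤ 2 * (m * τ * (p * m * L) * l) := by
    linarith [mul_le_mul_of_nonneg_left hlogn (show 0 ≤ m * τ * (p * m * L) by positivity)]
  linarith [show 0 ≤ m * τ * (p * m * L) * l by positivity]

end Estimates

variable {V : Type*} [Fintype V] (G : SimpleGraph V)

lemma two_le_card_of_nonempty_edgeSet [hE : Nonempty G.edgeSet] : 2 ≤ Fintype.card V := by
  obtain ⟨⟨e, he⟩⟩ := hE
  induction e using Sym2.ind with
  | h u v => exact Fintype.one_lt_card_iff.2 ⟨u, v, SimpleGraph.Adj.ne he⟩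

variable [DecidableRel G.Adj] {p q : ℝ}

lemma card_edgeSet_le_sq : Fintype.card G.edgeSet ≤ Fintype.card V ^ 2 := by
  classical
  rw [← SimpleGraph.edgeFinset_card]
  exact G.card_edgeFinset_le_card_choose_two.trans (Nat.choose_le_pow _ 2)

variable [DecidableEq V]

lemma exp_neg_le_rcMeasure (hq : 1 ≤ q) (hp0 : 0 < p) (hp1 : p < 1) {A : Config G}
    (hA : (A.card : ℝ) ≤ 16 * p * Fintype.card G.edgeSet) :
    Real.exp (-(Fintype.card V * q
      + 20 * p * Fintype.card G.edgeSet * Real.log (1 / min p (1 - p)))) ≤ rcMeasure G p q A := by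
  have hm : (Fintype.card G.edgeSet : ℝ) = A.card + (Aᶜ).card := by
    exact_mod_cast (card_add_card_compl A).symm
  have hvertices : q ^ Fintype.card V ≤ Real.exp (Fintype.card V * q) := by
    rw [Real.exp_nat_mul]
    gcongr
    linarith [Real.add_one_le_exp q]
  refine le_trans ?_ (le_rcMeasure G hq hp0 hp1 A)
  rw [neg_add_rev, Real.exp_add, Real.exp_neg (_ * q), ← div_eq_mul_inv]
  rw [hm] at hA ⊢
  have : 0 < 1 - p := sub_pos.2 hp1
  exact div_le_div₀ (by positivity) (exp_neg_le_pow_mul_pow hp0 hp1 hA) (by positivity) hvertices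

variable [Nonempty G.edgeSet]

lemma tvDist_glauber_pow_le (hq : 1 ≤ q) (hp0 : 0 < p) (hp1 : p < 1) {τ : ℕ} (hτ : τ ≠ 0)
    (hCM : mixingTime (chayesMachta G p q) (rcMeasure G p q) (1 / 4) ≤ τ) {t : ℕ}
    (ht : 2 * Fintype.card G.edgeSet * τ * (3 + Fintype.card V
      + 20 * p * Fintype.card G.edgeSet * Real.log (1 / min p (1 - p))) ≤ t)
    {A : Config G} (hA : (A.card : ℝ) ≤ 16 * p * Fintype.card G.edgeSet) :
    tvDist ((glauber G p q ^ t) A) (rcMeasure G p q) ≤ 1 / 8 := by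
  have hq0 : 0 < q := zero_lt_one.trans_le hq
  have hchain := chayesMachta_isReversibleChain G hq hp0 hp1
  have hgap := glauber_poincareInequality G hq hp0 hp1
    (hchain.poincareInequality_of_tvDist_le hτ (hchain.tvDist_le_of_mixingTime_le hCM))
  have hsq := (glauber_isReversibleChain G hq0 hp0 hp1).sq_tvDist_pow_le_of_poincareInequality
    hgap (glauber_mulVec_self_le G hq0 hp0 hp1) t A
  have hμ := exp_neg_le_rcMeasure G hq hp0 hp1 hA
  have hL := one_half_le_log_one_div_min hp0 hp1
  set L := Real.log (1 / min p (1 - p))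
  set m : ℝ := (Fintype.card G.edgeSet : ℝ)
  set n : ℝ := (Fintype.card V : ℝ)
  have hm : 0 < m := Nat.cast_pos.2 Fintype.card_pos
  have : (0 : ℝ) < τ := by exact_mod_cast hτ.bot_lt
  have hexponent : 3 + (n * q + 20 * p * m * L) ≤ q / m * (1 / (2 * τ)) * t := by
    calc 3 + (n * q + 20 * p * m * L) ≤ q * (3 + n + 20 * p * m * L) := by
          linarith [mul_le_mul_of_nonneg_right hq (show 0 ≤ 3 + 20 * p * m * L by positivity)]
      _ = q / m * (1 / (2 * τ)) * (2 * m * τ * (3 + n + 20 * p * m * L)) := by field_simp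
      _ ≤ q / m * (1 / (2 * τ)) * t := by gcongr
  have hratio : Real.exp (-(q / m * (1 / (2 * τ)) * t)) / rcMeasure G p q A ≤ (1 / 4) ^ 2 := by
    calc Real.exp (-(q / m * (1 / (2 * τ)) * t)) / rcMeasure G p q A
        ≤ Real.exp (-(3 + (n * q + 20 * p * m * L)))
          / Real.exp (-(n * q + 20 * p * m * L)) := by gcongr
      _ = Real.exp (-3) := by rw [← Real.exp_sub]; congr 1; ring
      _ ≤ Real.exp (-Real.log 16) := by gcongr; exact log_sixteen_le
      _ = (1 / 4) ^ 2 := by rw [Real.exp_neg, Real.exp_log (by norm_num)]; norm_num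
  linarith [(abs_le.1 (abs_le_of_sq_le_sq (hsq.trans hratio) (by norm_num))).2]

lemma mixingTime_glauber_le (hq : 1 ≤ q) (hp0 : 0 < p) (hp1 : p < 1) {τ : ℕ} (hτ : τ ≠ 0)
    (hCM : mixingTime (chayesMachta G p q) (rcMeasure G p q) (1 / 4) ≤ τ) :
    mixingTime (glauber G p q) (rcMeasure G p q) (1 / 4) ≤
      (⌈Fintype.card G.edgeSet * Real.log (16 * Fintype.card G.edgeSet)⌉₊
        + ⌈2 * Fintype.card G.edgeSet * τ * (3 + Fintype.card V
          + 20 * p * Fintype.card G.edgeSet * Real.log (1 / min p (1 - p)))⌉₊ : ℕ) := by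
  refine mixingTime_le fun A => ?_
  calc tvDist _ (rcMeasure G p q) ≤ 1 / 8 + 1 / 8 :=
        (glauber_isReversibleChain G (zero_lt_one.trans_le hq) hp0 hp1).tvDist_pow_add_le
          (fun B => (B.card : ℝ) ≤ 16 * p * Fintype.card G.edgeSet) (by norm_num)
          (glauber_pow_card_gt_le G hq hp0 hp1 (Nat.le_ceil _) A)
          fun B hB => tvDist_glauber_pow_le G hq hp0 hp1 hτ hCM (Nat.le_ceil _) hB
    _ = 1 / 4 := by norm_num

lemma toENNReal_mixingTime_glauber_le (hq : 1 ≤ q) (hp0 : 0 < p) (hp1 : p < 1) {τ : ℕ}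
    (hτ : τ ≠ 0) (hCM : mixingTime (chayesMachta G p q) (rcMeasure G p q) (1 / 4) ≤ τ) :
    (mixingTime (glauber G p q) (rcMeasure G p q) (1 / 4) : ℝ≥0∞) ≤
      ENNReal.ofReal (100 * (Fintype.card G.edgeSet * Fintype.card V * Real.log (Fintype.card V)
        + p * Fintype.card G.edgeSet ^ 2 * Real.log (Fintype.card V)
          * Real.log (1 / min p (1 - p)))) * τ := by
  refine (ENat.toENNReal_le.2 (mixingTime_glauber_le G hq hp0 hp1 hτ hCM)).trans ?_
  rw [ENat.toENNReal_coe, ← ENNReal.ofReal_natCast, ← ENNReal.ofReal_natCast τ,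
    ← ENNReal.ofReal_mul' τ.cast_nonneg]
  refine ENNReal.ofReal_le_ofReal ?_
  push_cast
  exact ceil_add_ceil_le (by exact_mod_cast Fintype.card_pos)
    (by exact_mod_cast two_le_card_of_nonempty_edgeSet G) (by exact_mod_cast card_edgeSet_le_sq G)
    (by exact_mod_cast hτ.bot_lt) hp0.le (by linarith [one_half_le_log_one_div_min hp0 hp1])

end MixingTime

end RandomCluster

end

open RandomCluster in
theorem mainTheorem2_general {V : Type*} [Fintype V] [DecidableEq V] (G : SimpleGraph V)
    [DecidableRel G.Adj] {q p : ℝ} (hq : 1 ≤ q) (hp0 : 0 < p) (hp1 : p < 1) :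
    (mixingTime (glauber G p q) (rcMeasure G p q) (1 / 4) : ℝ≥0∞) ≤
      ENNReal.ofReal (100 * (Fintype.card G.edgeSet * Fintype.card V * Real.log (Fintype.card V)
        + p * Fintype.card G.edgeSet ^ 2 * Real.log (Fintype.card V)
          * Real.log (1 / min p (1 - p)))) *
        (mixingTime (chayesMachta G p q) (rcMeasure G p q) (1 / 4) : ℝ≥0∞) := by
  rcases isEmpty_or_nonempty G.edgeSet with hE | hE
  · rw [mixingTime_eq_zero_of_subsingleton (P := glauber G p q)
      (sum_rcMeasure G (zero_lt_one.trans_le hq) hp0 hp1) (by norm_num)]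
    simp
  have hcoeff : 0 < 100 * (Fintype.card G.edgeSet * Fintype.card V * Real.log (Fintype.card V)
      + p * Fintype.card G.edgeSet ^ 2 * Real.log (Fintype.card V)
        * Real.log (1 / min p (1 - p))) := by
    have : (0 : ℝ) < Fintype.card G.edgeSet := Nat.cast_pos.2 Fintype.card_pos
    have hn : (2 : ℝ) ≤ Fintype.card V := by exact_mod_cast two_le_card_of_nonempty_edgeSet G
    have hlog := one_half_le_log hn
    have hL := one_half_le_log_one_div_min hp0 hp1
    positivity
  rcases eq_or_ne (mixingTime (chayesMachta G p q) (rcMeasure G p q) (1 / 4)) ⊤ with htop | hfin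
  · rw [htop, ENat.toENNReal_top, ENNReal.mul_top (ENNReal.ofReal_pos.2 hcoeff).ne']
    exact le_top
  · obtain ⟨τ, hτ⟩ := ENat.ne_top_iff_exists.1 hfin
    have hne := (chayesMachta_isReversibleChain G hq hp0 hp1).mixingTime_ne_zero
      (ε := 1 / 4) (by norm_num)
    rw [← hτ] at hne ⊢
    rw [ENat.toENNReal_coe]
    exact toENNReal_mixingTime_glauber_le G hq hp0 hp1 (by exact_mod_cast hne) hτ.ge

theorem mainTheorem2 :
    ∃ C : ℝ, 0 < C ∧
      ∀ (V : Type*) [Fintype V] [DecidableEq V] (G : SimpleGraph V) [DecidableRel G.Adj]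
        (q p : ℝ), 1 < q → 0 < p → p < 1 →
        ∀ n m : ℕ, n = Fintype.card V → m = G.edgeFinset.card →
          (RandomCluster.mixingTime (RandomCluster.glauber G p q)
              (RandomCluster.rcMeasure G p q) (1 / 4) : ℝ≥0∞) ≤
            ENNReal.ofReal (C * ((m : ℝ) * n * Real.log n +
                p * (m : ℝ) ^ 2 * Real.log n * Real.log (1 / min p (1 - p)))) *
              (RandomCluster.mixingTime (RandomCluster.chayesMachta G p q)
                (RandomCluster.rcMeasure G p q) (1 / 4) : ℝ≥0∞) := by
  refine ⟨100, by norm_num, ?_⟩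
  rintro V _ _ G _ q p hq hp0 hp1 n m rfl rfl
  rw [SimpleGraph.edgeFinset_card]
  exact mainTheorem2_general G hq.le hp0 hp1
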